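/- Let $\mathbb K=\mathbb R$ or $\mathbb C$, let $m,n_1,\dots,n_m$ be positive integers, $M=n_1+\cdots+n_m$, $p\in[2M,\infty)$ and $s\in(0,\infty)$. A map $P:\ell_p\times\cdots\times\ell_p\to\mathbb K$ ($m$ factors, $\ell_p=\ell_p(\mathbb K)$) is called an $(n_1,\dots,n_m)$-homogeneous polynomial if, for each $i$ and for all fixed values of the other variables, it is an $n_i$-homogeneous polynomial in its $i$-th variable, i.e. of the form $x\mapsto T(x,\dots,x)$ with $T$ an $n_i$-linear form. Put $\|P\|=\sup\{|P(x^{(1)},\dots,x^{(m)})| : \|x^{(1)}\|\le 1,\dots,\|x^{(m)}\|\le 1\}\in[0,\infty]$, and let $c_{\alpha^{(1)}\dots\alpha^{(m)}}(P)\in\mathbb K$ be the coefficients of the monomial expansion $$P(x^{(1)},\dots,x^{(m)})=\sum_{|\alpha^{(1)}|=n_1,\dots,|\alpha^{(m)}|=n_m}c_{\alpha^{(1)}\dots\alpha^{(m)}}(P)\,(x^{(1)})^{\alpha^{(1)}}\cdots(x^{(m)})^{\alpha^{(m)}},$$ which are uniquely determined by this identity for all finitely supported $x^{(1)},\dots,x^{(m)}\in\ell_p$;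 here $\alpha^{(i)}=(\alpha^{(i)}_j)_{j\ge1}$ runs over the sequences of nonnegative integers with $|\alpha^{(i)}|=\sum_j\alpha^{(i)}_j=n_i$, and $x^{\alpha}=\prod_j x_j^{\alpha_j}$. The following assertions are equivalent: (i) There is a constant $C\ge1$ (which may depend on $\mathbb K,m,n_1,\dots,n_m,p,s$, but not on $P$) such that $$\Big(\sum_{|\alpha^{(1)}|=n_1,\dots,|\alpha^{(m)}|=n_m}|c_{\alpha^{(1)}\dots\alpha^{(m)}}(P)|^{s}\Big)^{1/s}\le C\,\|P\|$$ for every $(n_1,\dots,n_m)$-homogeneous polynomial $P:\ell_p\times\cdots\times\ell_p\to\mathbb K$. (ii) $\displaystyle s\ge\frac{2Mp}{Mp+p-2M}.$ -/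

import Mathlib

open scoped ENNReal

/-- `p : E → F` is an `n`-homogeneous polynomial: the restriction to the diagonal of an
`n`-linear operator. -/
def IsHomogPoly (𝕜 : Type*) [Field 𝕜] {E F : Type*} [AddCommGroup E] [Module 𝕜 E]
    [AddCommGroup F] [Module 𝕜 F] (n : ℕ) (p : E → F) : Prop :=
  ∃ T : MultilinearMap 𝕜 (fun _ : Fin n => E) F, ∀ x, p x = T (fun _ => x)

/-- `P : E × ⋯ × E → F` is an `(n₁,…,nₘ)`-homogeneous polynomial: it is an `nᵢ`-homogeneous
polynomial in the `i`-th variable whenever the other variables are fixed. -/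
def IsMultiPoly (𝕜 : Type*) [Field 𝕜] {E F : Type*} [AddCommGroup E] [Module 𝕜 E]
    [AddCommGroup F] [Module 𝕜 F] {m : ℕ} (n : Fin m → ℕ) (P : (Fin m → E) → F) : Prop :=
  ∀ (i : Fin m) (x : Fin m → E), IsHomogPoly 𝕜 (n i) (fun y => P (Function.update x i y))

/-- The norm `sup {‖P x‖ : ‖x⁽¹⁾‖ ≤ 1, …, ‖x⁽ᵐ⁾‖ ≤ 1}`, as an element of `[0, ∞]`.
It is `∞` exactly when `P` is unbounded on the product of the unit balls (for a multihomogeneous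
polynomial: when it is not continuous), so that a bound by a multiple of the norm is a condition
on the continuous multihomogeneous polynomials only. -/
noncomputable def multiPolyNorm {E F : Type*} [Norm E] [ENorm F] {m : ℕ}
    (P : (Fin m → E) → F) : ℝ≥0∞ :=
  ⨆ (x : Fin m → E) (_ : ∀ i, ‖x i‖ ≤ 1), ‖P x‖ₑ

/-- Real or complex `ℓ_p`. -/
abbrev EllP (𝕜 : Type*) [RCLike 𝕜] (p : ℝ≥0∞) : Type _ := lp (fun _ : ℕ => 𝕜) p

/-- The tuples `(α⁽¹⁾,…,α⁽ᵐ⁾)` of multi-indices (sequences of nonnegative integers) with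
`|α⁽ⁱ⁾| = nᵢ` for every `i`. -/
def MultiIdx {m : ℕ} (n : Fin m → ℕ) : Type :=
  {α : Fin m → (ℕ →₀ ℕ) // ∀ i, (α i).degree = n i}

/-- The monomial `(x⁽¹⁾)^{α⁽¹⁾} ⋯ (x⁽ᵐ⁾)^{α⁽ᵐ⁾}`. -/
def monom {𝕜 : Type*} [RCLike 𝕜] {m : ℕ} {n : Fin m → ℕ} (α : MultiIdx n)
    (x : Fin m → ℕ → 𝕜) : 𝕜 :=
  ∏ i, (α.1 i).prod fun j a => x i j ^ a

/-- `P = ∑ c_α x^α`. The identity is required at all tuples of finitely supported vectors, where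
the sum has only finitely many nonzero terms (at general points of `ℓ_p` the monomial series
of a continuous homogeneous polynomial need not be unconditionally summable). -/
def IsMonomialExpansion {𝕜 : Type*} [RCLike 𝕜] {p : ℝ≥0∞} {m : ℕ} (n : Fin m → ℕ)
    (P : (Fin m → EllP 𝕜 p) → 𝕜) (c : MultiIdx n → 𝕜) : Prop :=
  ∀ x : Fin m → EllP 𝕜 p, (∀ i, {j | x i j ≠ 0}.Finite) →
    HasSum (fun α => c α * monom α (fun i j => x i j)) (P x)

section Expansion

variable {𝕜 : Type*} [RCLike 𝕜]

theorem sum_signs_superset {n : ℕ} (R : Finset (Fin n)) :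
    (∑ S : Finset (Fin n), if R ⊆ S then ((-1 : 𝕜)) ^ n * (-1) ^ S.card else 0)
      = if R = Finset.univ then 1 else 0 := by
  classical
  have key : (∑ S : Finset (Fin n), if R ⊆ S then ((-1 : 𝕜)) ^ S.card else 0)
      = (-1) ^ R.card * ∑ S ∈ (Finset.univ \ R).powerset, (-1 : 𝕜) ^ S.card := by
    rw [← Finset.sum_filter, Finset.mul_sum]
    refine Finset.sum_bij' (fun S _ => S \ R) (fun S _ => R ∪ S) ?_ ?_ ?_ ?_ ?_
    · intro S hS
      simp only [Finset.mem_powerset]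
      exact Finset.sdiff_subset_sdiff (Finset.subset_univ _) le_rfl
    · intro S hS
      simp
    · intro S hS
      simp only [Finset.mem_filter, Finset.mem_univ, true_and] at hS
      exact Finset.union_sdiff_of_subset hS
    · intro S hS
      simp only [Finset.mem_powerset] at hS
      have hd : Disjoint R S := (Finset.disjoint_sdiff).mono_right hS
      exact Finset.union_sdiff_cancel_left hd
    · intro S hS
      simp only [Finset.mem_filter, Finset.mem_univ, true_and] at hS
      rw [← pow_add, add_comm, Finset.card_sdiff_add_card_eq_card hS]
  have h2 : (∑ S ∈ (Finset.univ \ R).powerset, (-1 : 𝕜) ^ S.card)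
      = if Finset.univ \ R = ∅ then 1 else 0 := by
    have := Finset.sum_powerset_neg_one_pow_card (x := Finset.univ \ R)
    have h := congrArg (Int.cast : ℤ → 𝕜) this
    push_cast at h
    simpa using h
  have h3 : (∑ S : Finset (Fin n), if R ⊆ S then ((-1 : 𝕜)) ^ n * (-1) ^ S.card else 0)
      = (-1) ^ n * ∑ S : Finset (Fin n), if R ⊆ S then ((-1 : 𝕜)) ^ S.card else 0 := by
    rw [Finset.mul_sum]
    refine Finset.sum_congr rfl fun S _ => ?_
    split_ifs <;> simp
  rw [h3, key, h2]
  by_cases hR : R = Finset.univ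
  · subst hR
    simp [← pow_add, ← two_mul]
  · have : Finset.univ \ R ≠ ∅ := by
      intro h
      rw [Finset.sdiff_eq_empty_iff_subset] at h
      exact hR (Finset.univ_subset_iff.mp h)
    simp [hR, this]

theorem polarization_aux {E : Type*} [AddCommGroup E] [Module 𝕜 E] {n : ℕ}
    (T : MultilinearMap 𝕜 (fun _ : Fin n => E) 𝕜) (e : Fin n → E) :
    ∑ S : Finset (Fin n), ((-1 : 𝕜) ^ n * (-1) ^ S.card) * T (fun _ => ∑ k ∈ S, e k)
      = ∑ σ : Equiv.Perm (Fin n), T (fun k => e (σ k)) := by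
  classical
  have h1 : ∀ S : Finset (Fin n), T (fun _ => ∑ k ∈ S, e k)
      = ∑ r : Fin n → Fin n, if Finset.univ.image r ⊆ S then T (fun k => e (r k)) else 0 := by
    intro S
    rw [T.map_sum_finset (fun _ k => e k) (fun _ => S), ← Finset.sum_filter]
    refine Finset.sum_congr ?_ fun _ _ => rfl
    ext r
    simp [Fintype.mem_piFinset, Finset.image_subset_iff]
  simp_rw [h1, Finset.mul_sum]
  rw [Finset.sum_comm]
  have h2 : ∀ r : Fin n → Fin n,
      (∑ S : Finset (Fin n), ((-1 : 𝕜) ^ n * (-1) ^ S.card) *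
        (if Finset.univ.image r ⊆ S then T (fun k => e (r k)) else 0))
      = if Function.Bijective r then T (fun k => e (r k)) else 0 := by
    intro r
    have := sum_signs_superset (𝕜 := 𝕜) (Finset.univ.image r)
    have hb : Finset.univ.image r = Finset.univ ↔ Function.Bijective r := by
      rw [← Finite.surjective_iff_bijective, Finset.eq_univ_iff_forall]
      simp [Function.Surjective]
    calc _ = (∑ S : Finset (Fin n), if Finset.univ.image r ⊆ S then
            ((-1 : 𝕜)) ^ n * (-1) ^ S.card else 0) * T (fun k => e (r k)) := by
          rw [Finset.sum_mul]
          refine Finset.sum_congr rfl fun S _ => ?_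
          split_ifs <;> simp
      _ = _ := by
          rw [this]
          simp only [hb]
          split_ifs <;> simp
  rw [Finset.sum_congr rfl fun r _ => h2 r, ← Finset.sum_filter]
  symm
  refine Finset.sum_bij (fun (σ : Equiv.Perm (Fin n)) _ => (σ : Fin n → Fin n)) ?_ ?_ ?_ ?_
  · intro σ _
    exact Finset.mem_filter.2 ⟨Finset.mem_univ _, σ.bijective⟩
  · intro σ _ τ _ h
    exact DFunLike.coe_injective h
  · intro r hr
    simp only [Finset.mem_filter, Finset.mem_univ, true_and] at hr
    exact ⟨Equiv.ofBijective r hr, Finset.mem_univ _, rfl⟩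
  · intro σ _
    rfl

theorem IsHomogPoly.interp {E : Type*} [AddCommGroup E] [Module 𝕜 E] {n : ℕ} {q : E → 𝕜}
    (hq : IsHomogPoly 𝕜 n q) {A : Type} [Fintype A] (e : A → E) (y : A → 𝕜) :
    q (∑ j, y j • e j) = ∑ a : (Fin n → A) × Finset (Fin n),
      ((∏ k, y (a.1 k)) * ((-1) ^ n * (-1) ^ a.2.card / (n.factorial : 𝕜))) *
        q (∑ k ∈ a.2, e (a.1 k)) := by
  classical
  obtain ⟨T, hT⟩ := hq
  have hn : (n.factorial : 𝕜) ≠ 0 := by exact_mod_cast n.factorial_ne_zero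
  have hexp : ∀ σ : Equiv.Perm (Fin n), T (fun _ => ∑ j, y j • e j)
      = ∑ J : Fin n → A, (∏ k, y (J k)) * T (fun k => e (J (σ k))) := by
    intro σ
    rw [T.map_sum (fun _ j => y j • e j)]
    refine (Fintype.sum_equiv (Equiv.arrowCongr σ.symm (Equiv.refl A)) _ _ ?_).symm
    intro J
    rw [T.map_smul_univ]
    simp only [Equiv.arrowCongr_apply, Function.comp_apply, Equiv.symm_symm, Equiv.refl_apply,
      smul_eq_mul]
    congr 1
    exact (Equiv.prod_comp σ (fun k => y (J k))).symm
  have hsum : (n.factorial : 𝕜) * T (fun _ => ∑ j, y j • e j)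
      = ∑ J : Fin n → A, (∏ k, y (J k)) *
        ∑ S : Finset (Fin n), ((-1 : 𝕜) ^ n * (-1) ^ S.card) * T (fun _ => ∑ k ∈ S, e (J k)) := by
    have : (n.factorial : 𝕜) * T (fun _ => ∑ j, y j • e j)
        = ∑ _σ : Equiv.Perm (Fin n), T (fun _ => ∑ j, y j • e j) := by
      simp [Finset.card_univ, Fintype.card_perm]
    rw [this, Finset.sum_congr rfl fun σ _ => hexp σ, Finset.sum_comm]
    refine Finset.sum_congr rfl fun J _ => ?_
    rw [polarization_aux T (fun k => e (J k)), Finset.mul_sum]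
  rw [hT, ← mul_right_inj' hn, hsum, Fintype.sum_prod_type, Finset.mul_sum]
  refine Finset.sum_congr rfl fun J _ => ?_
  rw [Finset.mul_sum, Finset.mul_sum]
  refine Finset.sum_congr rfl fun S _ => ?_
  rw [hT]
  field_simp

theorem multi_interp {E : Type*} {m : ℕ} {κ : Fin m → Type} [∀ i, Fintype (κ i)]
    (u : ∀ i, κ i → 𝕜) (z : ∀ i, κ i → E) (y : Fin m → E) (f : (Fin m → E) → 𝕜)
    (h : ∀ i x, f (Function.update x i (y i)) = ∑ a, u i a * f (Function.update x i (z i a))) :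
    f y = ∑ a : (∀ i, κ i), (∏ i, u i (a i)) * f (fun i => z i (a i)) := by
  induction m with
  | zero =>
    simp only [Finset.univ_eq_empty, Finset.prod_empty, one_mul]
    rw [Fintype.sum_unique]
    congr 1
    exact Subsingleton.elim _ _
  | succ m ih =>
    have step : f y = ∑ a, u 0 a * f (Fin.cons (z 0 a) (Fin.tail y)) := by
      have := h 0 y
      rw [Function.update_eq_self] at this
      rw [this]
      refine Finset.sum_congr rfl fun a _ => ?_
      congr 2
      conv_lhs => rw [← Fin.cons_self_tail y, Fin.update_cons_zero]
    have rest : ∀ b : E, f (Fin.cons b (Fin.tail y))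
        = ∑ a : (∀ i : Fin m, κ i.succ), (∏ i, u i.succ (a i)) *
          f (Fin.cons b (fun i => z i.succ (a i))) := by
      intro b
      refine ih (κ := fun i => κ i.succ) (fun i => u i.succ) (fun i => z i.succ) (Fin.tail y)
        (fun x => f (Fin.cons b x)) ?_
      intro i x
      have := h i.succ (Fin.cons b x)
      simpa only [Fin.cons_update, Fin.tail] using this
    rw [step]
    simp_rw [rest, Finset.mul_sum]
    rw [← Fintype.sum_prod_type'
      (f := fun a (b : ∀ i : Fin m, κ i.succ) => u 0 a * ((∏ i, u i.succ (b i)) *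
        f (Fin.cons (z 0 a) (fun i => z i.succ (b i)))))]
    refine Fintype.sum_equiv (Fin.consEquiv κ) _ _ ?_
    rintro ⟨a, b⟩
    rw [Fin.prod_univ_succ]
    simp only [Fin.consEquiv_apply, Fin.cons_zero, Fin.cons_succ]
    rw [mul_assoc]
    congr 3
    funext i
    refine Fin.cases ?_ ?_ i <;> simp

/-- Every multihomogeneous polynomial has a monomial expansion. -/
theorem IsMultiPoly.exists_expansion {p : ℝ≥0∞} {m : ℕ} {n : Fin m → ℕ}
    {P : (Fin m → EllP 𝕜 p) → 𝕜} (hP : IsMultiPoly 𝕜 n P) :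
    ∃ c, IsMonomialExpansion n P c := by
  classical
  let e : ℕ → EllP 𝕜 p := fun j => lp.single p j 1
  let D : (∀ i, Fin (n i) → ℕ) → 𝕜 := fun J =>
    ∑ S : (∀ i, Finset (Fin (n i))),
      (∏ i, ((-1) ^ (n i) * (-1) ^ (S i).card / ((n i).factorial : 𝕜))) *
        P (fun i => ∑ k ∈ S i, e (J i k))
  let τ : (∀ i, Fin (n i) → ℕ) → MultiIdx n := fun J =>
    ⟨fun i => ∑ k, Finsupp.single (J i k) 1, fun i => by simp [map_sum]⟩
  have hmon : ∀ J (x : Fin m → ℕ → 𝕜), monom (τ J) x = ∏ i, ∏ k, x i (J i k) := by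
    intro J x
    refine Finset.prod_congr rfl fun i _ => ?_
    change (∑ k, Finsupp.single (J i k) 1).prod (fun j a => x i j ^ a) = _
    rw [← Finsupp.prod_finsetSum_index (by simp) (by simp [pow_add])]
    simp
  have hfib : ∀ α : MultiIdx n, {J | τ J = α}.Finite := by
    intro α
    refine (Set.Finite.pi' fun i => Set.Finite.pi' fun _ : Fin (n i) =>
      (α.1 i).support.finite_toSet).subset ?_
    rintro J rfl i k
    simp only [τ, Finset.mem_coe, Finsupp.mem_support_iff, Finsupp.finsetSum_apply]
    rw [← pos_iff_ne_zero]
    exact Finset.sum_pos' (by simp) ⟨k, Finset.mem_univ _, by simp⟩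
  refine ⟨fun α => ∑ J ∈ (hfib α).toFinset, D J, fun x hx => ?_⟩
  let A : Finset ℕ := Finset.univ.biUnion fun i => (hx i).toFinset
  have hxA : ∀ i, x i = ∑ j : A, x i j • e j := by
    intro i
    rw [Finset.sum_coe_sort A (fun j => x i j • e j)]
    ext j
    rw [lp.coeFn_sum, Finset.sum_apply]
    have hterm : ∀ k, (((x i k • e k : EllP 𝕜 p)) : ℕ → 𝕜) j
        = if k = j then x i k else 0 := by
      intro k
      rw [lp.coeFn_smul, Pi.smul_apply, lp.single_apply, Pi.single_apply]
      by_cases hk : k = j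
      · simp [hk]
      · simp [hk, Ne.symm hk]
    rw [Finset.sum_congr rfl fun k _ => hterm k, Finset.sum_ite_eq']
    split_ifs with hj
    · rfl
    · by_contra hne
      exact hj (Finset.mem_biUnion.2 ⟨i, Finset.mem_univ _, by simpa using hne⟩)
  have key := multi_interp
    (κ := fun i => (Fin (n i) → A) × Finset (Fin (n i)))
    (fun i a => (∏ k, x i (a.1 k)) *
      ((-1) ^ (n i) * (-1) ^ a.2.card / ((n i).factorial : 𝕜)))
    (fun i a => ∑ k ∈ a.2, e (a.1 k)) x P (by
      intro i w
      have := (hP i w).interp (A := A) (fun j => e j) (fun j => x i j)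
      rw [← hxA i] at this
      exact this)
  let ι : (∀ i, Fin (n i) → A) → (∀ i, Fin (n i) → ℕ) := fun J i k => J i k
  have hι : Function.Injective ι := by
    intro J J' h
    funext i k
    exact Subtype.ext (congrFun (congrFun h i) k)
  let B : Finset (∀ i, Fin (n i) → ℕ) := Finset.univ.image ι
  let G : (∀ i, Fin (n i) → ℕ) → 𝕜 := fun J => D J * monom (τ J) (fun i j => x i j)
  have hPx : P x = ∑ J ∈ B, G J := by
    rw [Finset.sum_image (fun _ _ _ _ h => hι h), key]
    let E : (∀ i, (Fin (n i) → A) × Finset (Fin (n i))) ≃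
        (∀ i, Fin (n i) → A) × (∀ i, Finset (Fin (n i))) :=
      ⟨fun a => (fun i => (a i).1, fun i => (a i).2), fun b i => (b.1 i, b.2 i),
        fun _ => rfl, fun _ => rfl⟩
    refine (Fintype.sum_equiv E _ (fun b => (∏ i, (∏ k, x i (b.1 i k)) *
      ((-1) ^ (n i) * (-1) ^ (b.2 i).card / ((n i).factorial : 𝕜))) *
        P (fun i => ∑ k ∈ b.2 i, e (b.1 i k))) (fun _ => rfl)).trans ?_
    rw [Fintype.sum_prod_type]
    refine Finset.sum_congr rfl fun J _ => ?_
    simp only [G, D, hmon, Finset.sum_mul]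
    refine Finset.sum_congr rfl fun S _ => ?_
    rw [Finset.prod_mul_distrib]
    ring
  have hG0 : ∀ J, J ∉ B → monom (τ J) (fun i j => x i j) = 0 := by
    intro J hJ
    rw [hmon]
    by_contra hne
    apply hJ
    have hall : ∀ i k, J i k ∈ A := by
      intro i k
      have h1 := (Finset.prod_ne_zero_iff.1 hne) i (Finset.mem_univ _)
      have h2 := (Finset.prod_ne_zero_iff.1 h1) k (Finset.mem_univ _)
      exact Finset.mem_biUnion.2 ⟨i, Finset.mem_univ _, by simpa using h2⟩
    exact Finset.mem_image.2 ⟨fun i k => ⟨J i k, hall i k⟩, Finset.mem_univ _, rfl⟩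
  have hterm : ∀ α : MultiIdx n, (∑ J ∈ (hfib α).toFinset, D J) *
      monom α (fun i j => x i j) = ∑ J ∈ B with τ J = α, G J := by
    intro α
    have h1 : (∑ J ∈ (hfib α).toFinset, D J) * monom α (fun i j => x i j)
        = ∑ J ∈ (hfib α).toFinset, G J := by
      rw [Finset.sum_mul]
      refine Finset.sum_congr rfl fun J hJ => ?_
      have : τ J = α := by simpa using hJ
      simp only [G, this]
    rw [h1]
    symm
    refine Finset.sum_subset ?_ ?_
    · intro J hJ
      simpa using (Finset.mem_filter.1 hJ).2
    · intro J hJ hJ'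
      have hτ : τ J = α := by simpa using hJ
      have : J ∉ B := fun hB => hJ' (Finset.mem_filter.2 ⟨hB, hτ⟩)
      simp [G, hG0 J this]
  have hmaps : ∀ J ∈ B, τ J ∈ B.image τ := fun J hJ => Finset.mem_image_of_mem _ hJ
  rw [hPx, ← Finset.sum_fiberwise_of_maps_to hmaps]
  simp only [hterm]
  refine hasSum_sum_of_ne_finset_zero ?_
  intro α hα
  refine Finset.sum_eq_zero fun J hJ => ?_
  obtain ⟨hJB, hτ⟩ := Finset.mem_filter.1 hJ
  exact absurd (hτ ▸ hmaps J hJB) hα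

/-- The monomial expansion is unique. -/
theorem IsMonomialExpansion.unique {p : ℝ≥0∞} {m : ℕ} {n : Fin m → ℕ}
    {P : (Fin m → EllP 𝕜 p) → 𝕜} {c c' : MultiIdx n → 𝕜}
    (hc : IsMonomialExpansion n P c) (hc' : IsMonomialExpansion n P c') : c = c' := by
  classical
  funext α₀
  let A : Finset ℕ := Finset.univ.biUnion fun i => (α₀.1 i).support
  let σ : MultiIdx n → (Fin m × ℕ →₀ ℕ) := fun α =>
    ∑ i, (α.1 i).mapDomain (fun j => (i, j))
  have hσ : ∀ (α : MultiIdx n) i j, σ α (i, j) = α.1 i j := by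
    intro α i j
    simp only [σ, Finsupp.finsetSum_apply]
    rw [Finset.sum_eq_single i]
    · exact Finsupp.mapDomain_apply (fun a b h => (Prod.mk.inj h).2) _ _
    · intro i' _ hi'
      refine Finsupp.mapDomain_of_notMem_range _ _ ?_
      rintro ⟨k, hk⟩
      exact hi' (Prod.mk.inj hk).1
    · simp
  have hσinj : Function.Injective σ := by
    intro α β h
    refine Subtype.ext (funext fun i => Finsupp.ext fun j => ?_)
    rw [← hσ, ← hσ, h]
  have hmon : ∀ (α : MultiIdx n) (x : Fin m → ℕ → 𝕜),
      monom α x = (σ α).prod fun q a => x q.1 q.2 ^ a := by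
    intro α x
    rw [← Finsupp.prod_finsetSum_index (by simp) (by simp [pow_add])]
    refine Finset.prod_congr rfl fun i _ => ?_
    rw [Finsupp.prod_mapDomain_index (by simp) (by simp [pow_add])]
  have hFfin : {α : MultiIdx n | ∀ i, (α.1 i).support ⊆ A}.Finite := by
    refine Set.Finite.of_finite_image (f := fun α : MultiIdx n => α.1) ?_
      (fun _ _ _ _ h => Subtype.ext h)
    refine (Set.Finite.pi' (t := fun i => {a : ℕ →₀ ℕ | a.support ⊆ A ∧ a.degree = n i})
      fun i => ?_).subset ?_
    · refine (Finset.finite_toSet (A.finsuppAntidiag (n i))).subset ?_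
      rintro a ⟨ha, hd⟩
      rw [Finset.mem_coe, Finset.mem_finsuppAntidiag]
      refine ⟨?_, ha⟩
      rw [← hd, Finsupp.degree_apply]
      exact (Finset.sum_subset ha fun j _ hj => by simpa using hj).symm
    · rintro _ ⟨α, hα, rfl⟩ i
      exact ⟨hα i, α.2 i⟩
  let Q : (MultiIdx n → 𝕜) → MvPolynomial (Fin m × ℕ) 𝕜 := fun c =>
    ∑ α ∈ hFfin.toFinset, MvPolynomial.monomial (σ α) (c α)
  have hQ : Q c = Q c' := by
    refine MvPolynomial.funext fun v => ?_
    let x : Fin m → EllP 𝕜 p := fun i => ∑ j ∈ A, lp.single p j (v (i, j))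
    have hxv : ∀ i j, x i j = if j ∈ A then v (i, j) else 0 := by
      intro i j
      simp only [x, lp.coeFn_sum, Finset.sum_apply, lp.single_apply, Pi.single_apply]
      rw [Finset.sum_ite_eq]
    have hx : ∀ i, {j | x i j ≠ 0}.Finite := by
      intro i
      refine A.finite_toSet.subset fun j hj => ?_
      by_contra hjA
      exact hj (by rw [hxv]; simp only [Finset.mem_coe] at hjA; simp [hjA])
    have hval : ∀ d : MultiIdx n → 𝕜, IsMonomialExpansion n P d →
        MvPolynomial.eval v (Q d) = P x := by
      intro d hd
      have hz : ∀ α ∉ hFfin.toFinset, d α * monom α (fun i j => x i j) = 0 := by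
        intro α hα
        simp only [Set.Finite.mem_toFinset, Set.mem_ofPred_eq, not_forall,
          Finset.not_subset] at hα
        obtain ⟨i, j, hj, hjA⟩ := hα
        have : monom α (fun i j => x i j) = 0 := by
          refine Finset.prod_eq_zero (Finset.mem_univ i) ?_
          refine Finset.prod_eq_zero hj ?_
          simp only [hxv, hjA, if_false]
          exact zero_pow (Finsupp.mem_support_iff.1 hj)
        rw [this, mul_zero]
      rw [(hd x hx).unique (hasSum_sum_of_ne_finset_zero hz)]
      simp only [Q, map_sum, MvPolynomial.eval_monomial]
      refine Finset.sum_congr rfl fun α hα => ?_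
      rw [hmon]
      congr 1
      refine Finset.prod_congr rfl fun q hq => ?_
      have hα' : ∀ i, (α.1 i).support ⊆ A := by simpa using hα
      have : q.2 ∈ A := by
        refine hα' q.1 ?_
        rw [Finsupp.mem_support_iff, ← hσ]
        exact Finsupp.mem_support_iff.1 hq
      simp [hxv, this]
    rw [hval c hc, hval c' hc']
  have hco : ∀ d : MultiIdx n → 𝕜, MvPolynomial.coeff (σ α₀) (Q d) = d α₀ := by
    intro d
    simp only [Q, MvPolynomial.coeff_sum, MvPolynomial.coeff_monomial, hσinj.eq_iff]
    rw [Finset.sum_ite_eq', if_pos]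
    simp only [Set.Finite.mem_toFinset, Set.mem_ofPred_eq]
    exact fun i => Finset.subset_biUnion_of_mem (fun i => (α₀.1 i).support) (Finset.mem_univ i)
  rw [← hco c, ← hco c', hQ]

end Expansion

/-- The coefficients `c_{α⁽¹⁾…α⁽ᵐ⁾}(P)`: the unique family with `P = ∑ c_α x^α`. -/
noncomputable def monomCoeff {𝕜 : Type*} [RCLike 𝕜] {p : ℝ≥0∞} {m : ℕ} {n : Fin m → ℕ}
    {P : (Fin m → EllP 𝕜 p) → 𝕜} (hP : IsMultiPoly 𝕜 n P) : MultiIdx n → 𝕜 :=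
  Classical.choose hP.exists_expansion

theorem monomCoeff_spec {𝕜 : Type*} [RCLike 𝕜] {p : ℝ≥0∞} {m : ℕ} {n : Fin m → ℕ}
    {P : (Fin m → EllP 𝕜 p) → 𝕜} (hP : IsMultiPoly 𝕜 n P) :
    IsMonomialExpansion n P (monomCoeff hP) :=
  Classical.choose_spec hP.exists_expansion

theorem monomCoeff_unique {𝕜 : Type*} [RCLike 𝕜] {p : ℝ≥0∞} {m : ℕ} {n : Fin m → ℕ}
    {P : (Fin m → EllP 𝕜 p) → 𝕜} (hP : IsMultiPoly 𝕜 n P) {c : MultiIdx n → 𝕜}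
    (hc : IsMonomialExpansion n P c) : monomCoeff hP = c :=
  (monomCoeff_spec hP).unique hc

/-!
Write `ρ = 2Mp / (Mp + p - 2M)`.

*The inequality for `s ≥ ρ`.* By polarization the monomial coefficients are sums of boundedly many
coefficients `a_J` of an `M`-linear form on `ℓ_p` whose norm is at most a constant times `‖P‖`
(`IsMultiPoly.monomCoeff_eq`, `IsMultiPoly.polarized_sum_smul`), so a multilinear inequality is
needed (`hardy_littlewood_multilinear`). Inserting random signs and Khinchine's inequality for chaos
gives, for every variable `k` and all multipliers `w⁽ˡ⁾` in the unit ball of `ℓ_p`, a bound of the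
`ℓ_1` norm in `J_k` of the `ℓ_2` norms of `a_J ∏ w⁽ˡ⁾` in the other variables
(`sum_sqrt_weighted_le`). The multipliers are then removed one variable at a time, each step
increasing the outer exponent `λ` by the rule `1/λ ↦ 1/λ - 1/p` (`mixed_sum_le_one`). The array with
`J`-th entry `a_J` is thus in the mixed `(λ, 2)` space for every distinguished variable, where
`1/λ = 1 - M/p`; here `p ≥ 2M` means `λ ≤ 2`. Interpolating between the `M` variables gives
`a ∈ ℓ_ρ` (`sum_rpow_le_one_of_mixed`).

*Necessity of `s ≥ ρ`.* Random signs yield `M`-linear forms on `N`-dimensional `ℓ_p` with all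
`N ^ M` coefficients `±1` and norm `O(N ^ (1/2 + M (1/2 - 1/p)) log N)`
(`exists_signs_multilinear_ellP_le`). Placing the variables on disjoint blocks of coordinates turns
such a form into an `(n₁, …, nₘ)`-homogeneous polynomial with the same coefficients (`blockPoly`).
The inequality for all `N` then forces `M / s ≤ 1/2 + M (1/2 - 1/p) = M / ρ`.
-/

/-! ### Khinchine's inequality for Rademacher chaos -/

section Chaos

open Finset
open scoped BigOperators

/-- The sign `±1` encoded by a Boolean. -/
def boolSign (𝕜 : Type*) [RCLike 𝕜] (b : Bool) : 𝕜 := if b then 1 else -1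

theorem norm_boolSign (𝕜 : Type*) [RCLike 𝕜] (b : Bool) : ‖boolSign 𝕜 b‖ = 1 := by
  cases b <;> simp [boolSign]

variable {𝕜 : Type*} [RCLike 𝕜]

theorem norm_add_pow_four_add_norm_sub_pow_four_le (z w : 𝕜) :
    ‖z + w‖ ^ 4 + ‖z - w‖ ^ 4 ≤ 2 * (‖z‖ ^ 4 + 6 * ‖z‖ ^ 2 * ‖w‖ ^ 2 + ‖w‖ ^ 4) := by
  have h1 := parallelogram_law_with_norm 𝕜 z w
  have h2 := norm_add_le z w
  have h3 := norm_sub_le z w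
  have h4 := norm_nonneg (z + w)
  have h5 := norm_nonneg (z - w)
  have h6 := norm_nonneg z
  have h7 := norm_nonneg w
  have h8 : ‖z + w‖ * ‖z + w‖ ≤ (‖z‖ + ‖w‖) * (‖z‖ + ‖w‖) := by gcongr
  have h9 : ‖z - w‖ * ‖z - w‖ ≤ (‖z‖ + ‖w‖) * (‖z‖ + ‖w‖) := by gcongr
  set a := ‖z + w‖ * ‖z + w‖ with ha
  set b := ‖z - w‖ * ‖z - w‖ with hb
  have ha' : ‖z + w‖ ^ 4 = a ^ 2 := by rw [ha]; ring
  have hb' : ‖z - w‖ ^ 4 = b ^ 2 := by rw [hb]; ring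
  rw [ha', hb']
  have hd : |a - b| ≤ 4 * ‖z‖ * ‖w‖ := by
    rw [abs_le]; constructor <;> nlinarith
  have hd2 : (a - b) ^ 2 ≤ (4 * ‖z‖ * ‖w‖) ^ 2 := sq_le_sq' (abs_le.1 hd).1 (abs_le.1 hd).2
  have hs : (a + b) ^ 2 = (2 * (‖z‖ * ‖z‖ + ‖w‖ * ‖w‖)) ^ 2 := by
    have h1' : a + b = 2 * (‖z‖ * ‖z‖ + ‖w‖ * ‖w‖) := by rw [ha, hb]; linarith
    rw [h1']
  nlinarith

theorem expect_fin_cons {n : ℕ} {β : Type*} [Fintype β] (F : (Fin (n + 1) → β) → ℝ) :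
    𝔼 ε, F ε = 𝔼 ε : Fin n → β, 𝔼 b : β, F (Fin.cons b ε) := by
  rw [Finset.expect_comm, ← Finset.expect_product']
  exact (Fintype.expect_equiv (Fin.consEquiv fun _ => β) _ _ fun _ => rfl).symm

theorem expect_bool (F : Bool → ℝ) : 𝔼 b, F b = (F true + F false) / 2 := by
  rw [Fintype.expect_eq_sum_div_card]
  simp

/-- Second and fourth moments of a Rademacher sum, by averaging over one sign at a time: the second
moment adds up by the parallelogram law, and `3S² + 6St + t² ≤ 3(S + t)²`. -/
theorem rademacher_moments {N : ℕ} (f : Fin N → 𝕜) :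
    (𝔼 ε : Fin N → Bool, ‖∑ j, boolSign 𝕜 (ε j) * f j‖ ^ 2 = ∑ j, ‖f j‖ ^ 2) ∧
    𝔼 ε : Fin N → Bool, ‖∑ j, boolSign 𝕜 (ε j) * f j‖ ^ 4 ≤ 3 * (∑ j, ‖f j‖ ^ 2) ^ 2 := by
  induction N with
  | zero => simp
  | succ N ih =>
    obtain ⟨ih2, ih4⟩ := ih (fun j => f j.succ)
    rw [expect_fin_cons, expect_fin_cons]
    simp only [Fin.sum_univ_succ, Fin.cons_zero, Fin.cons_succ, expect_bool]
    set X : (Fin N → Bool) → 𝕜 := fun ε => ∑ j : Fin N, boolSign 𝕜 (ε j) * f j.succ with hX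
    set S := ∑ j : Fin N, ‖f j.succ‖ ^ 2 with hS
    have hX2 : 𝔼 ε, ‖X ε‖ ^ 2 = S := ih2
    have hX4 : 𝔼 ε, ‖X ε‖ ^ 4 ≤ 3 * S ^ 2 := ih4
    constructor
    · rw [← hX2, ← Fintype.expect_const (ι := Fin N → Bool) (‖f 0‖ ^ 2), ← expect_add_distrib]
      refine expect_congr rfl fun ε _ => ?_
      have h1 := parallelogram_law_with_norm 𝕜 (X ε) (f 0)
      have e1 : boolSign 𝕜 true * f 0 + X ε = X ε + f 0 := by simp [boolSign]; ring
      have e2 : boolSign 𝕜 false * f 0 + X ε = X ε - f 0 := by simp [boolSign]; ring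
      change (‖boolSign 𝕜 true * f 0 + X ε‖ ^ 2 + ‖boolSign 𝕜 false * f 0 + X ε‖ ^ 2) / 2 = _
      rw [e1, e2]
      linarith
    · calc _ ≤ 𝔼 ε, (‖X ε‖ ^ 4 + 6 * ‖f 0‖ ^ 2 * ‖X ε‖ ^ 2 + ‖f 0‖ ^ 4) := by
            refine expect_le_expect fun ε _ => ?_
            have h1 := norm_add_pow_four_add_norm_sub_pow_four_le (X ε) (f 0)
            have e1 : boolSign 𝕜 true * f 0 + X ε = X ε + f 0 := by simp [boolSign]; ring
            have e2 : boolSign 𝕜 false * f 0 + X ε = X ε - f 0 := by simp [boolSign]; ring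
            change (‖boolSign 𝕜 true * f 0 + X ε‖ ^ 4 +
              ‖boolSign 𝕜 false * f 0 + X ε‖ ^ 4) / 2 ≤ _
            rw [e1, e2]
            linarith
        _ = 𝔼 ε, ‖X ε‖ ^ 4 + 6 * ‖f 0‖ ^ 2 * S + ‖f 0‖ ^ 4 := by
            rw [expect_add_distrib, expect_add_distrib, ← mul_expect, hX2, Fintype.expect_const]
        _ ≤ 3 * (‖f 0‖ ^ 2 + S) ^ 2 := by nlinarith [sq_nonneg (‖f 0‖ ^ 2)]

/-- The decoupled Rademacher chaos `∑ c_J ε⁽¹⁾_{J₁} ⋯ ε⁽ᴹ⁾_{J_M}` with coefficients `c`; the signs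
of the different variables are chosen independently. -/
def chaos {M N : ℕ} (c : (Fin M → Fin N) → 𝕜) (ε : Fin M → Fin N → Bool) : 𝕜 :=
  ∑ J, c J * ∏ l, boolSign 𝕜 (ε l (J l))

theorem sum_fin_cons {n : ℕ} {β E : Type*} [Fintype β] [AddCommMonoid E]
    (F : (Fin (n + 1) → β) → E) :
    ∑ J, F J = ∑ b : β, ∑ J : Fin n → β, F (Fin.cons b J) := by
  rw [← Fintype.sum_prod_type']
  exact (Fintype.sum_equiv (Fin.consEquiv fun _ => β) _ _ fun _ => rfl).symm

theorem chaos_cons {M N : ℕ} (c : (Fin (M + 1) → Fin N) → 𝕜) (e : Fin N → Bool)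
    (ε : Fin M → Fin N → Bool) :
    chaos c (Fin.cons e ε) = ∑ j, boolSign 𝕜 (e j) * chaos (fun J => c (Fin.cons j J)) ε := by
  unfold chaos
  rw [sum_fin_cons]
  refine sum_congr rfl fun j _ => ?_
  rw [mul_sum]
  refine sum_congr rfl fun J _ => ?_
  rw [Fin.prod_univ_succ]
  simp only [Fin.cons_zero, Fin.cons_succ]
  ring

/-- Second and fourth moments of a decoupled Rademacher chaos of degree `M`. The signs of the first
variable are averaged out first; the remaining mixed moments are bounded by Cauchy–Schwarz. -/
theorem chaos_moments {M N : ℕ} (c : (Fin M → Fin N) → 𝕜) :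
    (𝔼 ε, ‖chaos c ε‖ ^ 2 = ∑ J, ‖c J‖ ^ 2) ∧
    𝔼 ε, ‖chaos c ε‖ ^ 4 ≤ 3 ^ M * (∑ J, ‖c J‖ ^ 2) ^ 2 := by
  induction M with
  | zero =>
    simp only [chaos, Fintype.sum_unique, univ_eq_empty, prod_empty, mul_one,
      Fintype.expect_const, pow_zero, one_mul, true_and]
    exact le_of_eq (by ring)
  | succ M ih =>
    rw [expect_fin_cons, expect_fin_cons, sum_fin_cons]
    simp only [chaos_cons]
    set g : Fin N → (Fin M → Fin N → Bool) → 𝕜 := fun j => chaos (fun J => c (Fin.cons j J)) with hg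
    set S : Fin N → ℝ := fun j => ∑ J : Fin M → Fin N, ‖c (Fin.cons j J)‖ ^ 2 with hS
    have h2 : ∀ j, 𝔼 ε, ‖g j ε‖ ^ 2 = S j := fun j => (ih _).1
    have h4 : ∀ j, 𝔼 ε, ‖g j ε‖ ^ 4 ≤ 3 ^ M * S j ^ 2 := fun j => (ih _).2
    have hS0 : ∀ j, 0 ≤ S j := fun j => sum_nonneg fun _ _ => by positivity
    constructor
    · calc _ = 𝔼 ε, ∑ j, ‖g j ε‖ ^ 2 :=
            expect_congr rfl fun ε _ => (rademacher_moments fun j => g j ε).1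
        _ = _ := by
            rw [expect_sum_comm]
            exact sum_congr rfl fun j _ => h2 j
    · have hmix : ∀ j l, 𝔼 ε, ‖g j ε‖ ^ 2 * ‖g l ε‖ ^ 2 ≤ 3 ^ M * (S j * S l) := by
        intro j l
        have hcs := expect_mul_sq_le_sq_mul_sq univ (fun ε => ‖g j ε‖ ^ 2) (fun ε => ‖g l ε‖ ^ 2)
        have e : ∀ j, 𝔼 ε, (‖g j ε‖ ^ 2) ^ 2 = 𝔼 ε, ‖g j ε‖ ^ 4 := fun j =>
          expect_congr rfl fun ε _ => by ring
        rw [e, e] at hcs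
        have hb : (𝔼 ε, ‖g j ε‖ ^ 4) * 𝔼 ε, ‖g l ε‖ ^ 4 ≤ (3 ^ M * (S j * S l)) ^ 2 := by
          calc _ ≤ (3 ^ M * S j ^ 2) * (3 ^ M * S l ^ 2) :=
                mul_le_mul (h4 j) (h4 l) (expect_nonneg fun _ _ => by positivity) (by positivity)
            _ = _ := by ring
        have := hS0 j
        have := hS0 l
        exact (abs_le_of_sq_le_sq' (hcs.trans hb) (by positivity)).2
      calc _ ≤ 𝔼 ε, 3 * (∑ j, ‖g j ε‖ ^ 2) ^ 2 :=
            expect_le_expect fun ε _ => (rademacher_moments fun j => g j ε).2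
        _ = 3 * ∑ j, ∑ l, 𝔼 ε, ‖g j ε‖ ^ 2 * ‖g l ε‖ ^ 2 := by
            rw [← mul_expect]
            simp only [sq (∑ j, _), sum_mul_sum, expect_sum_comm]
        _ ≤ 3 * ∑ j, ∑ l, 3 ^ M * (S j * S l) := by
            gcongr with j _ l _
            exact hmix j l
        _ = 3 ^ (M + 1) * (∑ j, S j) ^ 2 := by
            simp only [sq (∑ j, _), sum_mul_sum, ← mul_sum]
            ring

/-- The `L¹`–`L²` Khinchine inequality for decoupled Rademacher chaos: a bound of the fourth moment
by the square of the second moment forces the first moment to be large. -/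
theorem sqrt_sum_sq_le_expect_chaos {M N : ℕ} (c : (Fin M → Fin N) → 𝕜) :
    Real.sqrt (∑ J, ‖c J‖ ^ 2) ≤ Real.sqrt 3 ^ M * 𝔼 ε, ‖chaos c ε‖ := by
  obtain ⟨h2, h4⟩ := chaos_moments c
  set S := Real.sqrt (∑ J, ‖c J‖ ^ 2) with hS
  have hS2 : ∑ J, ‖c J‖ ^ 2 = S ^ 2 := (Real.sq_sqrt (by positivity)).symm
  have hS0 : 0 ≤ S := Real.sqrt_nonneg _
  rw [hS2] at h2 h4
  have hA : 0 ≤ 𝔼 ε, ‖chaos c ε‖ := expect_nonneg fun _ _ => norm_nonneg _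
  rcases hS0.eq_or_lt with h0 | hpos
  · rw [← h0]; positivity
  set R := Real.sqrt 3 ^ M with hR
  have hR0 : 0 < R := by positivity
  have hR2 : R ^ 2 = 3 ^ M := by
    rw [hR, ← pow_mul, mul_comm, pow_mul, Real.sq_sqrt (by norm_num)]
  set τ := R * S with hτ
  -- From `X⁴ - 3τ²X² + 2τ³X = X (X - τ)² (X + 2τ) ≥ 0`; with `τ = R S` the fourth moment absorbs
  -- only a third of the second-moment term.
  have hpt : ∀ ε, 3 * τ ^ 2 * ‖chaos c ε‖ ^ 2 ≤ ‖chaos c ε‖ ^ 4 + 2 * τ ^ 3 * ‖chaos c ε‖ := by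
    intro ε
    have hx := norm_nonneg (chaos c ε)
    set x := ‖chaos c ε‖
    have hτ0 : 0 ≤ τ := by positivity
    have : 0 ≤ x * (x - τ) ^ 2 * (x + 2 * τ) := by positivity
    nlinarith
  have hE : 3 * τ ^ 2 * S ^ 2 ≤ 3 ^ M * (S ^ 2) ^ 2 + 2 * τ ^ 3 * 𝔼 ε, ‖chaos c ε‖ := by
    calc 3 * τ ^ 2 * S ^ 2 = 𝔼 ε, 3 * τ ^ 2 * ‖chaos c ε‖ ^ 2 := by rw [← mul_expect, h2]
      _ ≤ 𝔼 ε, (‖chaos c ε‖ ^ 4 + 2 * τ ^ 3 * ‖chaos c ε‖) := expect_le_expect fun ε _ => hpt ε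
      _ = 𝔼 ε, ‖chaos c ε‖ ^ 4 + 2 * τ ^ 3 * 𝔼 ε, ‖chaos c ε‖ := by
          rw [expect_add_distrib, ← mul_expect]
      _ ≤ _ := by gcongr
  rw [← hR2] at hE
  set A := 𝔼 ε, ‖chaos c ε‖
  have hfac : 2 * (R ^ 2 * S ^ 3) * S ≤ 2 * (R ^ 2 * S ^ 3) * (R * A) := by
    rw [hτ] at hE
    nlinarith
  exact le_of_mul_le_mul_left hfac (by positivity)

/-- The mixed `(ℓ₁, ℓ₂)` inequality for a multilinear form on `ℓ_p`, with multipliers from the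
unit ball of `ℓ_p` in every variable. -/
theorem sum_sqrt_weighted_le {M N : ℕ} {p B : ℝ} (a : (Fin M → Fin N) → 𝕜)
    (ha : ∀ x : Fin M → Fin N → 𝕜, (∀ l, ∑ j, ‖x l j‖ ^ p ≤ 1) → ‖∑ J, a J * ∏ l, x l (J l)‖ ≤ B)
    (k : Fin M) (w : Fin M → Fin N → ℝ) (hw0 : ∀ l j, 0 ≤ w l j)
    (hw : ∀ l, ∑ j, w l j ^ p ≤ 1) :
    ∑ i, Real.sqrt (∑ J with J k = i, ‖a J‖ ^ 2 * ∏ l, w l (J l) ^ 2) ≤ Real.sqrt 3 ^ M * B := by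
  let c : Fin N → (Fin M → Fin N) → 𝕜 := fun i J =>
    if J k = i then a J * ∏ l, (w l (J l) : 𝕜) else 0
  have hc : ∀ i, ∑ J with J k = i, ‖a J‖ ^ 2 * ∏ l, w l (J l) ^ 2 = ∑ J, ‖c i J‖ ^ 2 := by
    intro i
    rw [sum_filter]
    refine sum_congr rfl fun J _ => ?_
    simp only [c]
    split_ifs
    · rw [norm_mul, mul_pow, norm_prod, prod_pow]
      simp [abs_of_nonneg (hw0 _ _)]
    · simp
  have hpt : ∀ ε, ∑ i, ‖chaos (c i) ε‖ ≤ B := by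
    intro ε
    -- The phases `θ i` turn the sum of the absolute values into one value of the form.
    choose θ hθ1 hθ using fun i => RCLike.exists_norm_eq_mul_self (chaos (c i) ε)
    let x : Fin M → Fin N → 𝕜 := fun l j =>
      (if l = k then θ j else 1) * ((w l j : 𝕜) * boolSign 𝕜 (ε l j))
    have hxn : ∀ l j, ‖x l j‖ = w l j := by
      intro l j
      simp only [x, norm_mul, norm_boolSign, mul_one, RCLike.norm_ofReal, abs_of_nonneg (hw0 _ _)]
      split_ifs <;> simp [hθ1]
    have hx := ha x (fun l => by simpa only [hxn] using hw l)
    have hsum : ((∑ i, ‖chaos (c i) ε‖ : ℝ) : 𝕜) = ∑ J, a J * ∏ l, x l (J l) := by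
      rw [RCLike.ofReal_sum, sum_congr rfl fun i _ => hθ i]
      simp only [chaos, mul_sum]
      rw [sum_comm]
      refine sum_congr rfl fun J _ => ?_
      rw [sum_eq_single (J k) (fun i _ hi => by simp [c, hi.symm]) (by simp)]
      simp only [c, x, if_true, prod_mul_distrib, prod_ite_eq', mem_univ]
      ring
    rw [← hsum, RCLike.norm_ofReal] at hx
    exact (le_abs_self _).trans hx
  calc _ ≤ ∑ i, Real.sqrt 3 ^ M * 𝔼 ε, ‖chaos (c i) ε‖ := by
        gcongr with i _
        rw [hc]
        exact sqrt_sum_sq_le_expect_chaos _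
    _ = Real.sqrt 3 ^ M * 𝔼 ε, ∑ i, ‖chaos (c i) ε‖ := by
        rw [← mul_sum, expect_sum_comm]
    _ ≤ _ := by
        gcongr
        exact expect_le univ_nonempty fun ε _ => hpt ε

end Chaos

/-! ### The multilinear Hardy–Littlewood inequality -/

section Mixed

open Finset

/-- A sequence whose products with the unit ball of `ℓ_q` lie in the unit ball of `ℓ_μ` belongs to
the unit ball of `ℓ_ν`, where `1/ν = 1/μ - 1/q`; this relation is written as `ν = μ + μν/q`. -/
theorem sum_rpow_le_one_of_multipliers {ι : Type*} [Fintype ι] {q μ ν : ℝ} (hq : 0 < q)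
    (hμ : 0 < μ) (hν : 0 < ν) (hμν : ν = μ + μ * ν / q) (β : ι → ℝ) (hβ : ∀ j, 0 ≤ β j)
    (h : ∀ u : ι → ℝ, (∀ j, 0 ≤ u j) → ∑ j, u j ^ q ≤ 1 → ∑ j, (β j * u j) ^ μ ≤ 1) :
    ∑ j, β j ^ ν ≤ 1 := by
  by_contra! hσ
  set σ := ∑ j, β j ^ ν with hσdef
  have hσ0 : 0 < σ := by linarith
  have hβν : ∀ j, 0 ≤ β j ^ ν := fun j => Real.rpow_nonneg (hβ j) _
  have hquot : ∀ j, 0 ≤ β j ^ ν / σ := fun j => div_nonneg (hβν j) hσ0.le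
  -- the extremal multiplier for Hölder's inequality
  have key := h (fun j => (β j ^ ν / σ) ^ (1 / q)) (fun j => Real.rpow_nonneg (hquot j) _) (by
    simp only [← Real.rpow_mul (hquot _), one_div_mul_cancel hq.ne', Real.rpow_one]
    rw [← sum_div, div_self hσ0.ne'])
  have hterm : ∀ j, (β j * (β j ^ ν / σ) ^ (1 / q)) ^ μ = β j ^ ν * σ ^ (-(μ / q)) := by
    intro j
    rw [Real.mul_rpow (hβ j) (Real.rpow_nonneg (hquot j) _), ← Real.rpow_mul (hquot j),
      Real.div_rpow (hβν j) hσ0.le, ← Real.rpow_mul (hβ j), Real.rpow_neg hσ0.le, one_div_mul_eq_div,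
      div_eq_mul_inv, ← mul_assoc, ← Real.rpow_add_of_nonneg (hβ j) hμ.le (by positivity)]
    congr 2
    refine Eq.trans ?_ hμν.symm
    ring
  simp only [hterm] at key
  rw [← sum_mul, ← hσdef] at key
  have hexp : 0 < 1 - μ / q := by
    have : μ / q * ν = ν - μ := by
      nth_rewrite 2 [hμν]
      ring
    have h2 : μ / q * ν < 1 * ν := by linarith
    have := lt_of_mul_lt_mul_right h2 hν.le
    linarith
  have h1 : σ * σ ^ (-(μ / q)) = σ ^ (1 - μ / q) := by
    rw [sub_eq_add_neg, Real.rpow_add hσ0, Real.rpow_one]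
  rw [h1] at key
  exact absurd key (not_le.2 (Real.one_lt_rpow hσ hexp))

/-- Removing the multiplier `u`, which acts through the coordinate `c`, from a mixed inequality for
the sums along the fibres of another coordinate `r`, where `1/ν = 1/μ - 1/q`. The sums `β` along the
fibres of `c` are assumed to be in the unit ball of `ℓ_ν`, so `u = β ^ (ν/q)` is an admissible
multiplier; Hölder's inequality recovers `∑ d` from `∑ d β ^ (ν/q)` and `∑ d β ^ (ν-1)`, and the sum
of the latter over all fibres is `∑ β ^ ν ≤ 1`. -/
theorem sum_fiber_rpow_le_one_of_multipliers {𝒥 ι κ : Type*} [Fintype 𝒥] [Fintype ι] [Fintype κ]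
    [DecidableEq ι] [DecidableEq κ] {q μ ν : ℝ} (hq : 0 < q) (hμ : 0 < μ) (hν : 0 < ν)
    (hν1 : ν ≤ 1) (hμν : ν = μ + μ * ν / q) (d : 𝒥 → ℝ) (hd : ∀ J, 0 ≤ d J) (r : 𝒥 → ι)
    (c : 𝒥 → κ) (hc : ∑ l, (∑ J with c J = l, d J) ^ ν ≤ 1)
    (h : ∀ u : κ → ℝ, (∀ j, 0 ≤ u j) → ∑ j, u j ^ q ≤ 1 →
      ∑ i, (∑ J with r J = i, d J * u (c J)) ^ μ ≤ 1) :
    ∑ i, (∑ J with r J = i, d J) ^ ν ≤ 1 := by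
  rcases hν1.eq_or_lt with h1 | hlt
  · subst h1
    simp only [Real.rpow_one] at hc ⊢
    rwa [sum_fiberwise] at hc ⊢
  set β : κ → ℝ := fun l => ∑ J with c J = l, d J with hβ
  have hβ0 : ∀ l, 0 ≤ β l := fun l => sum_nonneg fun J _ => hd J
  have hdβ : ∀ J, d J ≤ β (c J) := fun J =>
    single_le_sum (f := d) (fun J _ => hd J) (mem_filter.2 ⟨mem_univ J, rfl⟩)
  have hκ : 0 < 1 - ν := by linarith
  -- Hölder exponent with `(ν - 1) + (1 - ν) P = ν / q`
  set P : ℝ := 1 + ν / (q * (1 - ν)) with hP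
  have hP1 : 1 ≤ P := by
    have : 0 ≤ ν / (q * (1 - ν)) := by positivity
    linarith
  have hP0 : 0 < P := by linarith
  set Y : ι → ℝ := fun i => ∑ J with r J = i, d J * β (c J) ^ (ν / q) with hY
  set Z : ι → ℝ := fun i => ∑ J with r J = i, d J * β (c J) ^ (-(1 - ν)) with hZ
  have hY0 : ∀ i, 0 ≤ Y i := fun i =>
    sum_nonneg fun J _ => mul_nonneg (hd J) (Real.rpow_nonneg (hβ0 _) _)
  have hZ0 : ∀ i, 0 ≤ Z i := fun i =>
    sum_nonneg fun J _ => mul_nonneg (hd J) (Real.rpow_nonneg (hβ0 _) _)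
  have hholder : ∀ i, ∑ J with r J = i, d J ≤ Z i ^ (1 - P⁻¹) * Y i ^ P⁻¹ := by
    intro i
    have := Real.inner_le_weight_mul_Lp_of_nonneg ({J | r J = i} : Finset 𝒥) hP1
      (fun J => d J * β (c J) ^ (-(1 - ν))) (fun J => β (c J) ^ (1 - ν))
      (fun J => mul_nonneg (hd J) (Real.rpow_nonneg (hβ0 _) _))
      (fun J => Real.rpow_nonneg (hβ0 _) _)
    refine (le_of_eq ?_).trans (this.trans (le_of_eq ?_))
    · refine sum_congr rfl fun J _ => ?_
      rcases (hβ0 (c J)).eq_or_lt with h0 | hpos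
      · have : d J = 0 := le_antisymm (h0 ▸ hdβ J) (hd J)
        simp [this]
      · rw [mul_assoc, ← Real.rpow_add hpos]
        simp
    · congr 2
      refine sum_congr rfl fun J _ => ?_
      rcases (hβ0 (c J)).eq_or_lt with h0 | hpos
      · have : d J = 0 := le_antisymm (h0 ▸ hdβ J) (hd J)
        simp [this]
      · rw [mul_assoc, ← Real.rpow_mul hpos.le, ← Real.rpow_add hpos]
        congr 2
        rw [hP]
        field_simp
        ring
  have hPinv : P⁻¹ = q * (1 - ν) / (q * (1 - ν) + ν) := by
    rw [hP]
    field_simp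
  have hPinv1 : P⁻¹ ≤ 1 := inv_le_one_of_one_le₀ hP1
  have hrat : ν / μ = 1 + ν / q := by
    nth_rewrite 1 [hμν]
    field_simp
  have hw : (1 - P⁻¹) * ν + P⁻¹ * (ν / μ) = 1 := by
    have hpos : 0 < q * (1 - ν) + ν := by positivity
    rw [hrat, hPinv]
    field_simp
    ring
  have hpt : ∀ i, (∑ J with r J = i, d J) ^ ν
      ≤ (1 - P⁻¹) * ν * Z i + P⁻¹ * (ν / μ) * Y i ^ μ := by
    intro i
    calc _ ≤ (Z i ^ (1 - P⁻¹) * Y i ^ P⁻¹) ^ ν :=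
          Real.rpow_le_rpow (sum_nonneg fun J _ => hd J) (hholder i) hν.le
      _ = Z i ^ ((1 - P⁻¹) * ν) * (Y i ^ μ) ^ (P⁻¹ * (ν / μ)) := by
          rw [Real.mul_rpow (Real.rpow_nonneg (hZ0 i) _) (Real.rpow_nonneg (hY0 i) _),
            ← Real.rpow_mul (hZ0 i), ← Real.rpow_mul (hY0 i), ← Real.rpow_mul (hY0 i)]
          congr 2
          field_simp
      _ ≤ _ := Real.geom_mean_le_arith_mean2_weighted (mul_nonneg (by linarith) hν.le)
          (by positivity) (hZ0 i) (Real.rpow_nonneg (hY0 i) _) hw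
  have hYsum : ∑ i, Y i ^ μ ≤ 1 := by
    refine h (fun l => β l ^ (ν / q)) (fun l => Real.rpow_nonneg (hβ0 l) _) ?_
    simpa only [← Real.rpow_mul (hβ0 _), div_mul_cancel₀ _ hq.ne'] using hc
  have hZsum : ∑ i, Z i ≤ 1 := by
    refine (le_of_eq ?_).trans hc
    rw [hZ, sum_fiberwise, ← sum_fiberwise (s := univ) (g := c)]
    refine sum_congr rfl fun l _ => ?_
    have : ∑ J with c J = l, d J * β (c J) ^ (-(1 - ν)) = β l * β l ^ (-(1 - ν)) := by
      rw [hβ, sum_mul]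
      refine sum_congr rfl fun J hJ => ?_
      rw [(mem_filter.1 hJ).2]
    rw [this]
    change _ = β l ^ ν
    rcases (hβ0 l).eq_or_lt with h0 | hpos
    · rw [← h0, zero_mul, Real.zero_rpow hν.ne']
    · nth_rewrite 1 [← Real.rpow_one (β l)]
      rw [← Real.rpow_add hpos]
      congr 1
      ring
  calc _ ≤ ∑ i, ((1 - P⁻¹) * ν * Z i + P⁻¹ * (ν / μ) * Y i ^ μ) := sum_le_sum fun i _ => hpt i
    _ = (1 - P⁻¹) * ν * ∑ i, Z i + P⁻¹ * (ν / μ) * ∑ i, Y i ^ μ := by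
        rw [sum_add_distrib, ← mul_sum, ← mul_sum]
    _ ≤ (1 - P⁻¹) * ν * 1 + P⁻¹ * (ν / μ) * 1 := by
        have : 0 ≤ (1 - P⁻¹) * ν := mul_nonneg (by linarith) hν.le
        gcongr
    _ = 1 := by linarith

/-- Removing the multipliers `W` of a mixed inequality one variable after the other: without the
multipliers of the variables in `K`, the outer exponent `1/2` grows to `q / (2q - #K)`. The
hypothesis `M ≤ q` keeps this exponent at most `1`. -/
theorem mixed_sum_le_one {M N : ℕ} {q : ℝ} (hq : (M : ℝ) ≤ q) (b : (Fin M → Fin N) → ℝ)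
    (hb : ∀ J, 0 ≤ b J)
    (h0 : ∀ (k : Fin M) (W : Fin M → Fin N → ℝ), (∀ l j, 0 ≤ W l j) →
      (∀ l, ∑ j, W l j ^ q ≤ 1) →
      ∑ i, (∑ J with J k = i, b J * ∏ l, W l (J l)) ^ (1 / 2 : ℝ) ≤ 1) (K : Finset (Fin M)) :
    ∀ (k : Fin M) (W : Fin M → Fin N → ℝ), (∀ l j, 0 ≤ W l j) → (∀ l ∈ K, ∀ j, W l j = 1) →
      (∀ l ∉ K, ∑ j, W l j ^ q ≤ 1) →
      ∑ i, (∑ J with J k = i, b J * ∏ l, W l (J l)) ^ (q / (2 * q - #K)) ≤ 1 := by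
  induction K using Finset.induction_on with
  | empty =>
    intro k W hW _ hW1
    have hq0 : 0 < q := lt_of_lt_of_le (by exact_mod_cast k.pos) hq
    have he : q / (2 * q - ((#(∅ : Finset (Fin M)) : ℕ) : ℝ)) = 1 / 2 := by
      simp only [card_empty, Nat.cast_zero, sub_zero]
      field_simp
    rw [he]
    exact h0 k W hW fun l => hW1 l (notMem_empty l)
  | insert k₀ K hk₀ ih =>
    intro k W hW hW1 hWq
    have hq0 : 0 < q := lt_of_lt_of_le (by exact_mod_cast k.pos) hq
    have hcard : ((#K : ℕ) : ℝ) + 1 ≤ q := by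
      have := card_le_univ (insert k₀ K)
      rw [card_insert_of_notMem hk₀, Fintype.card_fin] at this
      exact le_trans (by exact_mod_cast this) hq
    rw [card_insert_of_notMem hk₀, Nat.cast_succ]
    set t : ℝ := ((#K : ℕ) : ℝ) with ht
    have ht0 : 0 ≤ t := Nat.cast_nonneg _
    have hden : 0 < 2 * q - t := by linarith
    have hden' : 0 < 2 * q - (t + 1) := by linarith
    have hμ : 0 < q / (2 * q - t) := by positivity
    have hν : 0 < q / (2 * q - (t + 1)) := by positivity
    have hν1 : q / (2 * q - (t + 1)) ≤ 1 := by
      rw [div_le_one hden']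
      linarith
    have hμν : q / (2 * q - (t + 1)) = q / (2 * q - t) +
        q / (2 * q - t) * (q / (2 * q - (t + 1))) / q := by
      have e : 2 * q - (t + 1) = 2 * q - t - 1 := by ring
      rw [e] at hden' ⊢
      generalize 2 * q - t = D at hden hden' ⊢
      have := hden.ne'
      have := hden'.ne'
      field_simp
      ring
    set d : (Fin M → Fin N) → ℝ := fun J => b J * ∏ l, W l (J l) with hd
    have hd0 : ∀ J, 0 ≤ d J := fun J => mul_nonneg (hb J) (prod_nonneg fun l _ => hW l _)
    have hstep : ∀ (k : Fin M) (u : Fin N → ℝ), (∀ j, 0 ≤ u j) → ∑ j, u j ^ q ≤ 1 →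
        ∑ i, (∑ J with J k = i, d J * u (J k₀)) ^ (q / (2 * q - t)) ≤ 1 := by
      intro k u hu hu1
      have hdu : ∀ J, b J * ∏ l, Function.update W k₀ u l (J l) = d J * u (J k₀) := by
        intro J
        have e1 := Fintype.prod_eq_mul_prod_compl k₀ fun l => Function.update W k₀ u l (J l)
        have e2 := Fintype.prod_eq_mul_prod_compl k₀ fun l => W l (J l)
        have e3 : ∏ l ∈ {k₀}ᶜ, Function.update W k₀ u l (J l) = ∏ l ∈ {k₀}ᶜ, W l (J l) := by
          refine prod_congr rfl fun l hl => ?_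
          rw [Function.update_of_ne (by simpa using hl)]
        rw [e1, e3, Function.update_self, hd]
        simp only [e2, hW1 k₀ (mem_insert_self _ _)]
        ring
      have := ih k (Function.update W k₀ u) (by
        intro l j
        by_cases hl : l = k₀
        · subst hl; simpa using hu j
        · simpa [hl] using hW l j) (by
        intro l hl j
        have hne : l ≠ k₀ := fun e => hk₀ (e ▸ hl)
        simpa [hne] using hW1 l (mem_insert_of_mem hl) j) (by
        intro l hl
        by_cases hlk : l = k₀
        · subst hlk; simpa using hu1
        · simpa [hlk] using hWq l (by simp [hlk, hl]))
      simpa only [hdu] using this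
    -- The sums along the fibres of `k₀` itself are controlled first, then all the others.
    refine sum_fiber_rpow_le_one_of_multipliers hq0 hμ hν hν1 hμν d hd0 (fun J => J k)
      (fun J => J k₀) ?_ (hstep k)
    refine sum_rpow_le_one_of_multipliers hq0 hμ hν hμν _ (fun l => sum_nonneg fun J _ => hd0 J) ?_
    intro u hu hu1
    refine (le_of_eq ?_).trans (hstep k₀ u hu hu1)
    refine sum_congr rfl fun j _ => ?_
    congr 1
    rw [sum_mul]
    refine sum_congr rfl fun J hJ => ?_
    rw [(mem_filter.1 hJ).2]

/-- Interpolation of the `M` mixed inequalities (a form of Blei's inequality). With `β k` the sums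
along the fibres of the `k`-th coordinate, `b ^ (Mα)` is the product of the factors
`(b β_k ^ (ν-1)) ^ α` and of `(∏ β_k ^ ν) ^ (1 - Mα)`; the weighted arithmetic-geometric mean
inequality applies, and each of the resulting sums is at most `1`. -/
theorem sum_rpow_le_one_of_mixed {M N : ℕ} {ν : ℝ} (hM : 1 ≤ M) (hν : 0 < ν) (hν1 : ν ≤ 1)
    (b : (Fin M → Fin N) → ℝ) (hb : ∀ J, 0 ≤ b J)
    (h : ∀ k, ∑ i, (∑ J with J k = i, b J) ^ ν ≤ 1) :
    ∑ J, b J ^ (M * (ν / (1 + ν * (M - 1)))) ≤ 1 := by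
  have hM' : (1 : ℝ) ≤ M := by exact_mod_cast hM
  have hden : 0 < 1 + ν * (M - 1) := by
    have : 0 ≤ ν * (M - 1) := mul_nonneg hν.le (by linarith)
    linarith
  set α : ℝ := ν / (1 + ν * (M - 1)) with hα
  have hα0 : 0 < α := div_pos hν hden
  have hMα : 1 - M * α = (1 - ν) / (1 + ν * (M - 1)) := by
    rw [hα]
    field_simp
    ring
  have hMα0 : 0 ≤ 1 - M * α := by
    rw [hMα]
    exact div_nonneg (by linarith) hden.le
  have hexp : (ν - 1) * α + ν * (1 - M * α) = 0 := by
    rw [hMα, hα]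
    field_simp
    ring
  set β : Fin M → Fin N → ℝ := fun k i => ∑ J with J k = i, b J with hβ
  have hβ0 : ∀ k i, 0 ≤ β k i := fun k i => sum_nonneg fun J _ => hb J
  have hbβ : ∀ k J, b J ≤ β k (J k) := fun k J =>
    single_le_sum (f := b) (fun J _ => hb J) (mem_filter.2 ⟨mem_univ J, rfl⟩)
  have hpt : ∀ J, b J ^ (M * α) ≤ (1 - M * α) * ∏ k, β k (J k) ^ ν +
      ∑ k, α * (b J * β k (J k) ^ (ν - 1)) := by
    intro J
    have hr1 : ∀ k, 0 ≤ β k (J k) ^ ν := fun k => Real.rpow_nonneg (hβ0 _ _) _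
    have hr2 : ∀ k, 0 ≤ b J * β k (J k) ^ (ν - 1) := fun k =>
      mul_nonneg (hb J) (Real.rpow_nonneg (hβ0 _ _) _)
    have key := Real.geom_mean_le_arith_mean_weighted (univ : Finset (Option (Fin M)))
      (fun o => o.elim (1 - M * α) fun _ => α)
      (fun o => o.elim (∏ k, β k (J k) ^ ν) fun k => b J * β k (J k) ^ (ν - 1))
      (by rintro (_ | k) _ <;> simp [hMα0, hα0.le])
      (by simp [Fintype.sum_option])
      (by
        rintro (_ | k) _
        · exact prod_nonneg fun k _ => hr1 k
        · exact hr2 k)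
    rw [Fintype.prod_option, Fintype.sum_option] at key
    simp only [Option.elim] at key
    refine le_trans (le_of_eq ?_) key
    rcases (hb J).eq_or_lt with h0 | hpos
    · rw [← h0, Real.zero_rpow (by positivity)]
      have : Nonempty (Fin M) := ⟨⟨0, hM⟩⟩
      simp [Real.zero_rpow hα0.ne', show M ≠ 0 by omega]
    · have hβpos : ∀ k, 0 < β k (J k) := fun k => hpos.trans_le (hbβ k J)
      rw [← Real.finsetProd_rpow _ _ fun k _ => hr1 k, ← prod_mul_distrib]
      have hterm : ∀ k, (β k (J k) ^ ν) ^ (1 - M * α) * (b J * β k (J k) ^ (ν - 1)) ^ α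
          = b J ^ α := by
        intro k
        rw [Real.mul_rpow hpos.le (Real.rpow_nonneg (hβ0 _ _) _), ← Real.rpow_mul (hβ0 _ _),
          ← Real.rpow_mul (hβ0 _ _), mul_left_comm, ← Real.rpow_add (hβpos k), add_comm, hexp,
          Real.rpow_zero, mul_one]
      simp only [hterm, prod_const, card_univ, Fintype.card_fin]
      rw [← Real.rpow_mul_natCast hpos.le, mul_comm]
  have hβsum : ∀ k, ∑ J, b J * β k (J k) ^ (ν - 1) ≤ 1 := by
    intro k
    refine (le_of_eq ?_).trans (h k)
    rw [← sum_fiberwise (s := univ) (g := fun J => J k)]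
    refine sum_congr rfl fun i _ => ?_
    have : ∑ J with J k = i, b J * β k (J k) ^ (ν - 1) = β k i * β k i ^ (ν - 1) := by
      rw [hβ, sum_mul]
      refine sum_congr rfl fun J hJ => ?_
      rw [(mem_filter.1 hJ).2]
    rw [this]
    change _ = β k i ^ ν
    rcases (hβ0 k i).eq_or_lt with h0 | hpos
    · rw [← h0, zero_mul, Real.zero_rpow hν.ne']
    · nth_rewrite 1 [← Real.rpow_one (β k i)]
      rw [← Real.rpow_add hpos]
      congr 1
      ring
  calc ∑ J, b J ^ (M * α) ≤ ∑ J, ((1 - M * α) * ∏ k, β k (J k) ^ ν +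
        ∑ k, α * (b J * β k (J k) ^ (ν - 1))) := sum_le_sum fun J _ => hpt J
    _ = (1 - M * α) * ∏ k, ∑ i, β k i ^ ν + ∑ k, α * ∑ J, b J * β k (J k) ^ (ν - 1) := by
        rw [sum_add_distrib, ← mul_sum, sum_comm, prod_univ_sum]
        simp only [mul_sum, Fintype.piFinset_univ]
    _ ≤ (1 - M * α) * 1 + ∑ k : Fin M, α * 1 := by
        gcongr with k _
        · exact prod_le_one (fun k _ => sum_nonneg fun i _ => Real.rpow_nonneg (hβ0 _ _) _)
            fun k _ => h k
        · exact hβsum k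
    _ = 1 := by simp

/-- The multilinear Hardy–Littlewood inequality for finite arrays: the coefficients of an `M`-linear
form bounded by `B` on the unit balls of `ℓ_p`, `p ≥ 2M`. -/
theorem hardy_littlewood_multilinear {𝕜 : Type*} [RCLike 𝕜] {M N : ℕ} (hM : 1 ≤ M) {p s B : ℝ}
    (hp : 2 * (M : ℝ) ≤ p) (hs : 2 * M * p / (M * p + p - 2 * M) ≤ s) (hB : 0 < B)
    (a : (Fin M → Fin N) → 𝕜)
    (ha : ∀ x : Fin M → Fin N → 𝕜, (∀ l, ∑ j, ‖x l j‖ ^ p ≤ 1) →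
      ‖∑ J, a J * ∏ l, x l (J l)‖ ≤ B) :
    ∑ J, ‖a J‖ ^ s ≤ (Real.sqrt 3 ^ M * B) ^ s := by
  have hM' : (1 : ℝ) ≤ M := by exact_mod_cast hM
  have hp0 : 0 < p := by linarith
  set R := Real.sqrt 3 ^ M * B with hR
  have hR0 : 0 < R := by positivity
  set q := p / 2 with hq
  have hMq : (M : ℝ) ≤ q := by rw [hq]; linarith
  have hden : 0 < 2 * q - M := by linarith
  set b : (Fin M → Fin N) → ℝ := fun J => (‖a J‖ / R) ^ 2 with hb
  have hmix := mixed_sum_le_one hMq b (fun J => sq_nonneg _) (by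
    intro k W hW hW1
    have h1 := sum_sqrt_weighted_le a ha k (fun l j => Real.sqrt (W l j))
      (fun l j => Real.sqrt_nonneg _) (by
        intro l
        simpa only [Real.sqrt_eq_rpow, ← Real.rpow_mul (hW _ _), one_div_mul_eq_div] using hW1 l)
    have h2 : ∀ i, (∑ J with J k = i, b J * ∏ l, W l (J l)) ^ (1 / 2 : ℝ)
        = R⁻¹ * Real.sqrt (∑ J with J k = i, ‖a J‖ ^ 2 * ∏ l, Real.sqrt (W l (J l)) ^ 2) := by
      intro i
      rw [← Real.sqrt_eq_rpow, ← Real.sqrt_sq (inv_nonneg.2 hR0.le), ← Real.sqrt_mul (sq_nonneg _),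
        mul_sum]
      congr 1
      refine sum_congr rfl fun J _ => ?_
      simp only [Real.sq_sqrt (hW _ _), hb]
      ring
    simp only [h2]
    rw [← mul_sum, inv_mul_le_iff₀ hR0, mul_one]
    exact h1) univ
  have hfin : ∀ k, ∑ i, (∑ J with J k = i, b J) ^ (q / (2 * q - M)) ≤ 1 := by
    intro k
    simpa using hmix k (fun _ _ => 1) (fun _ _ => zero_le_one) (fun _ _ _ => rfl) (by simp)
  have hblei := sum_rpow_le_one_of_mixed hM (div_pos (by linarith) hden)
    ((div_le_one hden).2 (by linarith)) b (fun J => sq_nonneg _) hfin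
  have hexp : 2 * ((M : ℝ) * (q / (2 * q - M) / (1 + q / (2 * q - M) * (M - 1))))
      = 2 * M * p / (M * p + p - 2 * M) := by
    have e1 : 1 + q / (2 * q - M) * (M - 1) = (M * q + q - M) / (2 * q - M) := by
      rw [eq_div_iff hden.ne', add_mul, mul_right_comm, div_mul_cancel₀ _ hden.ne']
      ring
    have h3 : 0 < M * q + q - M := by nlinarith
    have h4 : M * p + p - 2 * M = 2 * (M * q + q - M) := by rw [hq]; ring
    rw [e1, h4, div_div_div_cancel_right₀ hden.ne', hq]
    field_simp
  have hle1 : ∀ J, ‖a J‖ / R ≤ 1 := by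
    intro J
    have hJ : b J ^ ((M : ℝ) * (q / (2 * q - M) / (1 + q / (2 * q - M) * (M - 1)))) ≤ 1 :=
      (single_le_sum (fun J _ => Real.rpow_nonneg (sq_nonneg (‖a J‖ / R)) _)
        (mem_univ J)).trans hblei
    by_contra! hgt
    refine absurd hJ (not_le.2 (Real.one_lt_rpow (one_lt_pow₀ hgt two_ne_zero) ?_))
    have : 0 < q / (2 * q - M) := div_pos (by linarith) hden
    have : 0 ≤ q / (2 * q - M) * ((M : ℝ) - 1) := mul_nonneg this.le (by linarith)
    positivity
  have hsum : ∑ J, (‖a J‖ / R) ^ s ≤ 1 := by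
    refine (sum_le_sum fun J _ => ?_).trans hblei
    have h0 : 0 ≤ ‖a J‖ / R := by positivity
    simp only [hb]
    rw [← Real.rpow_natCast, ← Real.rpow_mul h0, Nat.cast_ofNat, hexp]
    rcases h0.eq_or_lt with hz | hpos
    · have hρ : 0 < 2 * M * p / (M * p + p - 2 * M) := by
        have : 0 < M * p + p - 2 * M := by nlinarith
        positivity
      rw [← hz, Real.zero_rpow (hρ.trans_le hs).ne', Real.zero_rpow hρ.ne']
    · exact Real.rpow_le_rpow_of_exponent_ge hpos (hle1 J) hs
  have hfac : ∀ J, (‖a J‖ / R) ^ s = ‖a J‖ ^ s / R ^ s := fun J =>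
    Real.div_rpow (norm_nonneg _) hR0.le _
  simp only [hfac] at hsum
  rwa [← sum_div, div_le_one (Real.rpow_pos_of_pos hR0 s)] at hsum

end Mixed

/-! ### Polarization of multihomogeneous polynomials -/

section Polarization

open Finset

variable {𝕜 : Type*} [RCLike 𝕜]

/-- Two families of finitely supported functionals that agree on every slice of `f` have the same
tensor product on `f`. -/
theorem tensor_functional_congr {E : Type*} [Nonempty E] {m : ℕ} {κ κ' : Fin m → Type} [∀ i, Fintype (κ i)]
    [∀ i, Fintype (κ' i)] (u : ∀ i, κ i → 𝕜) (z : ∀ i, κ i → E) (u' : ∀ i, κ' i → 𝕜)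
    (z' : ∀ i, κ' i → E) (f : (Fin m → E) → 𝕜)
    (h : ∀ i x, ∑ a, u i a * f (Function.update x i (z i a)) =
      ∑ a, u' i a * f (Function.update x i (z' i a))) :
    ∑ a : (∀ i, κ i), (∏ i, u i (a i)) * f (fun i => z i (a i)) =
      ∑ a : (∀ i, κ' i), (∏ i, u' i (a i)) * f (fun i => z' i (a i)) := by
  induction m with
  | zero =>
    simp only [univ_eq_empty, prod_empty, one_mul]
    rw [Fintype.sum_unique, Fintype.sum_unique]
    congr 1
    exact Subsingleton.elim _ _
  | succ m ih =>
    have split : ∀ {κ : Fin (m + 1) → Type} [∀ i, Fintype (κ i)] (u : ∀ i, κ i → 𝕜)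
        (z : ∀ i, κ i → E), ∑ a : (∀ i, κ i), (∏ i, u i (a i)) * f (fun i => z i (a i)) =
        ∑ b, u 0 b * ∑ a : (∀ i : Fin m, κ i.succ), (∏ i, u i.succ (a i)) *
          f (Fin.cons (z 0 b) fun i => z i.succ (a i)) := by
      intro κ _ u z
      simp_rw [mul_sum]
      rw [← Fintype.sum_prod_type'
        (f := fun b (a : ∀ i : Fin m, κ i.succ) => u 0 b * ((∏ i, u i.succ (a i)) *
          f (Fin.cons (z 0 b) (fun i => z i.succ (a i)))))]
      refine (Fintype.sum_equiv (Fin.consEquiv κ) _ _ ?_).symm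
      rintro ⟨b, a⟩
      rw [Fin.prod_univ_succ]
      simp only [Fin.consEquiv_apply, Fin.cons_zero, Fin.cons_succ]
      rw [mul_assoc]
      congr 3
      funext i
      refine Fin.cases ?_ ?_ i <;> simp
    rw [split, split]
    have tail : ∀ b : E, ∑ a : (∀ i : Fin m, κ i.succ), (∏ i, u i.succ (a i)) *
          f (Fin.cons b fun i => z i.succ (a i)) =
        ∑ a : (∀ i : Fin m, κ' i.succ), (∏ i, u' i.succ (a i)) *
          f (Fin.cons b fun i => z' i.succ (a i)) := by
      intro b
      refine ih (fun i => u i.succ) (fun i => z i.succ) (fun i => u' i.succ)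
        (fun i => z' i.succ) (fun x => f (Fin.cons b x)) fun i x => ?_
      have := h i.succ (Fin.cons b x)
      simpa only [Fin.cons_update] using this
    simp_rw [tail, mul_sum]
    rw [sum_comm]
    nth_rewrite 2 [sum_comm]
    refine sum_congr rfl fun a _ => ?_
    obtain ⟨w⟩ := ‹Nonempty E›
    have head := h 0 (Fin.cons w fun i => z' i.succ (a i))
    simp only [Fin.update_cons_zero] at head
    simp only [mul_left_comm (u 0 _), mul_left_comm (u' 0 _), ← mul_sum, head]

/-- The value at `y` of the symmetric multilinear form attached to the multihomogeneous polynomial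
`P` by the polarization formula, one block of `n i` variables for each variable of `P`. -/
noncomputable def polarized {E : Type*} [AddCommGroup E] {m : ℕ} (n : Fin m → ℕ)
    (P : (Fin m → E) → 𝕜) (y : ∀ i, Fin (n i) → E) : 𝕜 :=
  ∑ S : (∀ i, Finset (Fin (n i))),
    (∏ i, ((-1) ^ (n i) * (-1) ^ (S i).card / ((n i).factorial : 𝕜))) *
      P (fun i => ∑ k ∈ S i, y i k)

theorem IsHomogPoly.polarization_sum_smul {E : Type*} [AddCommGroup E] [Module 𝕜 E] {n : ℕ}
    {q : E → 𝕜} (hq : IsHomogPoly 𝕜 n q) {A : Type} [Fintype A] (e : A → E)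
    (y : Fin n → A → 𝕜) :
    ∑ S : Finset (Fin n), ((-1) ^ n * (-1) ^ S.card / (n.factorial : 𝕜)) *
        q (∑ k ∈ S, ∑ j, y k j • e j) =
      ∑ a : (Fin n → A) × Finset (Fin n), ((∏ k, y k (a.1 k)) *
        ((-1) ^ n * (-1) ^ a.2.card / (n.factorial : 𝕜))) * q (∑ k ∈ a.2, e (a.1 k)) := by
  classical
  obtain ⟨T, hT⟩ := hq
  have hpol : ∀ v : Fin n → E, ∑ S : Finset (Fin n),
      ((-1) ^ n * (-1) ^ S.card / (n.factorial : 𝕜)) * q (∑ k ∈ S, v k) =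
        (n.factorial : 𝕜)⁻¹ * ∑ σ : Equiv.Perm (Fin n), T (fun k => v (σ k)) := by
    intro v
    rw [← polarization_aux T v, mul_sum]
    refine sum_congr rfl fun S _ => ?_
    rw [hT]
    ring
  have hexp : ∀ σ : Equiv.Perm (Fin n), T (fun k => ∑ j, y (σ k) j • e j)
      = ∑ J : Fin n → A, (∏ k, y k (J k)) * T (fun k => e (J (σ k))) := by
    intro σ
    rw [T.map_sum (fun k j => y (σ k) j • e j)]
    refine (Fintype.sum_equiv (Equiv.arrowCongr σ.symm (Equiv.refl A)) _ _ ?_).symm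
    intro J
    rw [T.map_smul_univ]
    simp only [Equiv.arrowCongr_apply, Function.comp_apply, Equiv.symm_symm, Equiv.refl_apply,
      smul_eq_mul]
    congr 1
    exact (Equiv.prod_comp σ (fun k => y k (J k))).symm
  rw [hpol, sum_congr rfl fun σ _ => hexp σ, sum_comm, Fintype.sum_prod_type, mul_sum]
  refine sum_congr rfl fun J _ => ?_
  simp only [mul_assoc, ← mul_sum]
  rw [hpol, mul_left_comm]

/-- The polarization of a multihomogeneous polynomial is multilinear: its expansion over linear
combinations of given vectors. -/
theorem IsMultiPoly.polarized_sum_smul {E : Type*} [AddCommGroup E] [Module 𝕜 E] {m : ℕ}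
    {n : Fin m → ℕ} {P : (Fin m → E) → 𝕜} (hP : IsMultiPoly 𝕜 n P) {A : Type} [Fintype A]
    (e : A → E) (y : ∀ i, Fin (n i) → A → 𝕜) :
    polarized n P (fun i k => ∑ j, y i k j • e j) =
      ∑ J : (∀ i, Fin (n i) → A), polarized n P (fun i k => e (J i k)) *
        ∏ i, ∏ k, y i k (J i k) := by
  have h := tensor_functional_congr (κ := fun i => Finset (Fin (n i)))
    (κ' := fun i => (Fin (n i) → A) × Finset (Fin (n i)))
    (fun i S => (-1) ^ (n i) * (-1) ^ S.card / ((n i).factorial : 𝕜))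
    (fun i S => ∑ k ∈ S, ∑ j, y i k j • e j)
    (fun i a => (∏ k, y i k (a.1 k)) *
      ((-1) ^ (n i) * (-1) ^ a.2.card / ((n i).factorial : 𝕜)))
    (fun i a => ∑ k ∈ a.2, e (a.1 k)) P
    (fun i x => (hP i x).polarization_sum_smul e (y i))
  refine h.trans ?_
  let E : (∀ i, (Fin (n i) → A) × Finset (Fin (n i))) ≃
      (∀ i, Fin (n i) → A) × (∀ i, Finset (Fin (n i))) :=
    ⟨fun a => (fun i => (a i).1, fun i => (a i).2), fun b i => (b.1 i, b.2 i),
      fun _ => rfl, fun _ => rfl⟩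
  refine (Fintype.sum_equiv E _ (fun b => (∏ i, (∏ k, y i k (b.1 i k)) *
    ((-1) ^ (n i) * (-1) ^ (b.2 i).card / ((n i).factorial : 𝕜))) *
      P (fun i => ∑ k ∈ b.2 i, e (b.1 i k))) (fun _ => rfl)).trans ?_
  rw [Fintype.sum_prod_type]
  refine sum_congr rfl fun J _ => ?_
  rw [polarized, sum_mul]
  refine sum_congr rfl fun S _ => ?_
  rw [prod_mul_distrib]
  ring

/-- A multihomogeneous polynomial is the diagonal of its polarization. -/
theorem IsMultiPoly.eq_polarized {E : Type*} [AddCommGroup E] [Module 𝕜 E] {m : ℕ}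
    {n : Fin m → ℕ} {P : (Fin m → E) → 𝕜} (hP : IsMultiPoly 𝕜 n P) (x : Fin m → E) :
    P x = polarized n P (fun i _ => x i) := by
  have h := tensor_functional_congr (κ := fun _ => Unit) (κ' := fun i => Finset (Fin (n i)))
    (fun _ _ => (1 : 𝕜)) (fun i _ => x i)
    (fun i S => (-1) ^ (n i) * (-1) ^ S.card / ((n i).factorial : 𝕜))
    (fun i S => ∑ _k ∈ S, x i) P (by
      intro i v
      obtain ⟨T, hT⟩ := hP i v
      have hT' : ∀ y, P (Function.update v i y) = T fun _ => y := hT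
      have hn : ((n i).factorial : 𝕜) ≠ 0 := by exact_mod_cast (n i).factorial_ne_zero
      have h1 := polarization_aux T (fun _ => x i)
      simp only [sum_const (T fun _ => x i), card_univ, Fintype.card_perm, Fintype.card_fin,
        nsmul_eq_mul] at h1
      simp only [Fintype.sum_unique, one_mul, hT', div_mul_eq_mul_div, ← sum_div]
      rw [h1, mul_div_cancel_left₀ _ hn])
  simpa [polarized] using h

/-- The multi-index of the monomial `∏ x⁽ⁱ⁾_{J i k}`: it counts how often each coordinate occurs in
the tuple `J i`. -/
noncomputable def tupleIdx {m : ℕ} {n : Fin m → ℕ} (J : ∀ i, Fin (n i) → ℕ) : MultiIdx n :=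
  ⟨fun i => ∑ k, Finsupp.single (J i k) 1, fun i => by simp [map_sum]⟩

theorem monom_tupleIdx {m : ℕ} {n : Fin m → ℕ} (J : ∀ i, Fin (n i) → ℕ) (x : Fin m → ℕ → 𝕜) :
    monom (tupleIdx J) x = ∏ i, ∏ k, x i (J i k) := by
  refine prod_congr rfl fun i _ => ?_
  change (∑ k, Finsupp.single (J i k) 1).prod (fun j a => x i j ^ a) = _
  rw [← Finsupp.prod_finsetSum_index (by simp) (by simp [pow_add])]
  simp

theorem mem_support_of_tupleIdx_eq {m : ℕ} {n : Fin m → ℕ} {J : ∀ i, Fin (n i) → ℕ}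
    {α : MultiIdx n} (h : tupleIdx J = α) (i : Fin m) (k : Fin (n i)) :
    J i k ∈ (α.1 i).support := by
  subst h
  simp only [tupleIdx, Finsupp.mem_support_iff, Finsupp.finsetSum_apply]
  rw [← pos_iff_ne_zero]
  exact sum_pos' (by simp) ⟨k, mem_univ _, by simp⟩

open Classical in
/-- The finite set of the tuples `J` with `tupleIdx J = α`. The entries of such a tuple lie in the
supports of `α`. -/
noncomputable def tupleFiber {m : ℕ} {n : Fin m → ℕ} (α : MultiIdx n) :
    Finset (∀ i, Fin (n i) → ℕ) :=
  {J ∈ Fintype.piFinset fun i => Fintype.piFinset fun _ : Fin (n i) => (α.1 i).support |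
    tupleIdx J = α}

theorem mem_tupleFiber {m : ℕ} {n : Fin m → ℕ} {α : MultiIdx n} {J : ∀ i, Fin (n i) → ℕ} :
    J ∈ tupleFiber α ↔ tupleIdx J = α := by
  simp only [tupleFiber, mem_filter, Fintype.mem_piFinset, and_iff_right_iff_imp]
  exact fun h i k => mem_support_of_tupleIdx_eq h i k

/-- There are at most `∏ nᵢ ^ nᵢ` tuples with a given multi-index, independently of the latter. -/
theorem card_tupleFiber_le {m : ℕ} {n : Fin m → ℕ} (α : MultiIdx n) :
    #(tupleFiber α) ≤ ∏ i, n i ^ n i := by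
  classical
  refine (card_filter_le _ _).trans ?_
  simp only [Fintype.card_piFinset, prod_const, card_univ, Fintype.card_fin]
  refine prod_le_prod' fun i _ => Nat.pow_le_pow_left ?_ _
  rw [card_eq_sum_ones, ← α.2 i, Finsupp.degree_apply]
  exact sum_le_sum fun j hj => Nat.one_le_iff_ne_zero.2 (Finsupp.mem_support_iff.1 hj)

theorem lp_eq_sum_smul_single {p : ℝ≥0∞} {A : Finset ℕ} (x : EllP 𝕜 p)
    (hx : ∀ j ∉ A, x j = 0) : x = ∑ j : A, x j • (lp.single p (j : ℕ) 1 : EllP 𝕜 p) := by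
  rw [Finset.sum_coe_sort A (fun j => x j • (lp.single p j 1 : EllP 𝕜 p))]
  ext j
  rw [lp.coeFn_sum, Finset.sum_apply]
  have hterm : ∀ k, ((x k • lp.single p k 1 : EllP 𝕜 p) : ℕ → 𝕜) j = if k = j then x k else 0 := by
    intro k
    rw [lp.coeFn_smul, Pi.smul_apply, lp.single_apply, Pi.single_apply]
    by_cases hk : k = j
    · simp [hk]
    · simp [hk, Ne.symm hk]
  rw [sum_congr rfl fun k _ => hterm k, sum_ite_eq']
  split_ifs with hj
  · rfl
  · exact hx j hj

/-- The monomial coefficients as sums of coefficients of the polarization. -/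
theorem IsMultiPoly.monomCoeff_eq {p : ℝ≥0∞} {m : ℕ} {n : Fin m → ℕ}
    {P : (Fin m → EllP 𝕜 p) → 𝕜} (hP : IsMultiPoly 𝕜 n P) (α : MultiIdx n) :
    monomCoeff hP α = ∑ J ∈ tupleFiber α, polarized n P (fun i k => lp.single p (J i k) 1) := by
  classical
  refine congrFun (monomCoeff_unique hP (c := fun α => ∑ J ∈ tupleFiber α,
    polarized n P (fun i k => lp.single p (J i k) 1)) fun x hx => ?_) α
  let A : Finset ℕ := univ.biUnion fun i => (hx i).toFinset
  have hA : ∀ i, ∀ j ∉ A, x i j = 0 := by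
    intro i j hj
    by_contra hne
    exact hj (mem_biUnion.2 ⟨i, mem_univ _, by simpa using hne⟩)
  let D : (∀ i, Fin (n i) → ℕ) → 𝕜 := fun J => polarized n P (fun i k => lp.single p (J i k) 1)
  let ι : (∀ i, Fin (n i) → A) → (∀ i, Fin (n i) → ℕ) := fun J i k => J i k
  have hι : Function.Injective ι := fun J J' h =>
    funext fun i => funext fun k => Subtype.ext (congrFun (congrFun h i) k)
  have hPx : P x = ∑ J : (∀ i, Fin (n i) → A), D (ι J) * ∏ i, ∏ k, x i (ι J i k) := by
    have h := hP.polarized_sum_smul (fun j : A => (lp.single p (j : ℕ) 1 : EllP 𝕜 p))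
      (fun i _ j => x i j)
    rw [hP.eq_polarized x]
    refine Eq.trans ?_ h
    congr 1
    funext i _
    exact lp_eq_sum_smul_single (x i) (hA i)
  have hsum : HasSum (fun J => D J * ∏ i, ∏ k, x i (J i k)) (P x) := by
    rw [hPx, ← sum_image (f := fun J => D J * ∏ i, ∏ k, x i (J i k)) (fun _ _ _ _ h => hι h)]
    refine hasSum_sum_of_ne_finset_zero fun J hJ => ?_
    by_contra hne
    refine hJ (mem_image.2 ⟨fun i k => ⟨J i k, ?_⟩, mem_univ _, rfl⟩)
    by_contra hk
    exact hne (mul_eq_zero_of_right _ (prod_eq_zero (mem_univ i)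
      (prod_eq_zero (mem_univ k) (hA i _ hk))))
  have hsig := ((Equiv.sigmaFiberEquiv (tupleIdx (n := n))).hasSum_iff.2 hsum)
  refine hsig.sigma fun α => ?_
  have hfib : ∀ J : {J // tupleIdx J = α}, (((fun J => D J * ∏ i, ∏ k, x i (J i k)) ∘
      Equiv.sigmaFiberEquiv (tupleIdx (n := n))) ⟨α, J⟩) = D J * monom α (fun i j => x i j) := by
    rintro ⟨J, rfl⟩
    rw [monom_tupleIdx]
    rfl
  simp only [hfib]
  refine HasSum.mul_right _ ?_
  have hfin : (tupleFiber α : Set (∀ i, Fin (n i) → ℕ)) = {J | tupleIdx J = α} := by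
    ext J
    exact mem_tupleFiber
  have := (tupleFiber α).hasSum D
  simpa using (Equiv.subtypeEquivRight fun J => mem_tupleFiber (α := α) (J := J)).hasSum_iff
    (f := fun J : {J // tupleIdx J = α} => D J) |>.1 this

end Polarization

/-! ### Boundedness of the monomial coefficients -/

section Upper

open Finset

variable {𝕜 : Type*} [RCLike 𝕜]

theorem norm_polarized_le {E : Type*} [AddCommGroup E] {m : ℕ} {n : Fin m → ℕ}
    {P : (Fin m → E) → 𝕜} {y : ∀ i, Fin (n i) → E} {b : ℝ}
    (hb : ∀ S : (∀ i, Finset (Fin (n i))), ‖P fun i => ∑ k ∈ S i, y i k‖ ≤ b) :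
    ‖polarized n P y‖ ≤ 2 ^ (∑ i, n i) * b := by
  have hb0 : 0 ≤ b := (norm_nonneg _).trans (hb fun _ => ∅)
  refine (norm_sum_le _ _).trans ?_
  have hterm : ∀ S : (∀ i, Finset (Fin (n i))),
      ‖(∏ i, ((-1 : 𝕜) ^ (n i) * (-1) ^ (S i).card / ((n i).factorial : 𝕜))) *
        P (fun i => ∑ k ∈ S i, y i k)‖ ≤ b := by
    intro S
    rw [norm_mul, norm_prod]
    refine (mul_le_of_le_one_left (norm_nonneg _) ?_).trans (hb S)
    refine prod_le_one (fun _ _ => norm_nonneg _) fun i _ => ?_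
    simp only [norm_div, norm_mul, norm_pow, norm_neg, norm_one, one_pow, mul_one,
      RCLike.norm_natCast]
    exact div_le_one_of_le₀ (by exact_mod_cast (n i).factorial_pos) (Nat.cast_nonneg _)
  refine (sum_le_sum fun S _ => hterm S).trans (le_of_eq ?_)
  simp [Fintype.card_pi, prod_pow_eq_pow_sum]

theorem norm_sum_smul_single_le {p : ℝ} (hp : 0 < p) {N : ℕ} (x : Fin N → 𝕜) {r : ℝ} (hr : 0 ≤ r)
    (hx : ∑ j, ‖x j‖ ^ p ≤ r ^ p) :
    ‖∑ j, x j • (lp.single (ENNReal.ofReal p) (j : ℕ) 1 : EllP 𝕜 (ENNReal.ofReal p))‖ ≤ r := by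
  have hpr : (ENNReal.ofReal p).toReal = p := ENNReal.toReal_ofReal hp.le
  let f : ℕ → 𝕜 := fun j => if h : j < N then x ⟨j, h⟩ else 0
  have hf : ∀ j : Fin N, f j = x j := fun j => by simp [f]
  have e : ∑ j, x j • (lp.single (ENNReal.ofReal p) (j : ℕ) 1 : EllP 𝕜 (ENNReal.ofReal p))
      = ∑ j ∈ range N, lp.single (ENNReal.ofReal p) j (f j) := by
    rw [← Fin.sum_univ_eq_sum_range
      (fun j => (lp.single (ENNReal.ofReal p) j (f j) : EllP 𝕜 (ENNReal.ofReal p)))]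
    refine sum_congr rfl fun j _ => ?_
    rw [hf, ← lp.single_smul (E := fun _ : ℕ => 𝕜)]
    simp
  have h1 := lp.norm_sum_single (E := fun _ : ℕ => 𝕜) (p := ENNReal.ofReal p) (by rw [hpr]; exact hp) f (range N)
  rw [hpr, ← Fin.sum_univ_eq_sum_range (fun j : ℕ => ‖f j‖ ^ p)] at h1
  simp only [hf] at h1
  rw [e]
  refine (Real.rpow_le_rpow_iff (lp.norm_nonneg' _) hr hp).1 ?_
  rw [h1]
  exact hx

/-- The Hardy–Littlewood inequality for the coefficients of the polarization. -/
theorem IsMultiPoly.sum_norm_polarized_rpow_le {m : ℕ} {n : Fin m → ℕ} {M : ℕ}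
    (hM : M = ∑ i, n i) (hM1 : 1 ≤ M) {p s b : ℝ} (hp : 2 * (M : ℝ) ≤ p)
    (hs : 2 * M * p / (M * p + p - 2 * M) ≤ s) (hb : 0 < b)
    {P : (Fin m → EllP 𝕜 (ENNReal.ofReal p)) → 𝕜} (hP : IsMultiPoly 𝕜 n P)
    (hPb : ∀ x, (∀ i, ‖x i‖ ≤ 1) → ‖P x‖ ≤ b) (N : ℕ) :
    ∑ J : (∀ i, Fin (n i) → Fin N),
      ‖polarized n P (fun i k => lp.single (ENNReal.ofReal p) (J i k : ℕ) 1)‖ ^ s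
        ≤ (Real.sqrt 3 ^ M * ((2 * M) ^ M * b)) ^ s := by
  have hM' : (1 : ℝ) ≤ M := by exact_mod_cast hM1
  have hp0 : 0 < p := by linarith
  have : Fact (1 ≤ ENNReal.ofReal p) := ⟨by rw [ENNReal.one_le_ofReal]; linarith⟩
  let e : (Σ i, Fin (n i)) ≃ Fin M := Fintype.equivFinOfCardEq (by simp [hM])
  let E : (Fin M → Fin N) ≃ (∀ i, Fin (n i) → Fin N) :=
    (Equiv.arrowCongr e.symm (Equiv.refl _)).trans (Equiv.piCurry fun i (_ : Fin (n i)) => Fin N)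
  have hE : ∀ J i k, E J i k = J (e ⟨i, k⟩) := fun J i k => rfl
  let D : (∀ i, Fin (n i) → Fin N) → 𝕜 := fun J =>
    polarized n P (fun i k => lp.single (ENNReal.ofReal p) (J i k : ℕ) 1)
  have h := hardy_littlewood_multilinear (N := N) hM1 hp hs (B := (2 * M) ^ M * b) (by positivity)
    (fun J => D (E J)) (fun x hx => ?_)
  · rwa [E.sum_comp (fun J => ‖D J‖ ^ s)] at h
  have hprod : ∀ J : Fin M → Fin N, ∏ l, x l (J l) = ∏ i, ∏ k, x (e ⟨i, k⟩) (E J i k) := by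
    intro J
    rw [← e.prod_comp, Fintype.prod_sigma]
    rfl
  simp only [hprod]
  rw [E.sum_comp (fun J => D J * ∏ i, ∏ k, x (e ⟨i, k⟩) (J i k))]
  -- dividing every vector by `M` brings all partial sums of a block into the unit ball
  have hscale := hP.polarized_sum_smul
    (fun j : Fin N => (lp.single (ENNReal.ofReal p) (j : ℕ) 1 : EllP 𝕜 (ENNReal.ofReal p)))
    (fun i k j => (M : 𝕜)⁻¹ * x (e ⟨i, k⟩) j)
  have hhom : ∀ J : (∀ i, Fin (n i) → Fin N), ∏ i, ∏ k, ((M : 𝕜)⁻¹ * x (e ⟨i, k⟩) (J i k))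
      = ((M : 𝕜) ^ M)⁻¹ * ∏ i, ∏ k, x (e ⟨i, k⟩) (J i k) := by
    intro J
    simp only [prod_mul_distrib, prod_const, card_univ, Fintype.card_fin, inv_pow,
      prod_inv_distrib, prod_pow_eq_pow_sum, ← hM]
  simp only [hhom, mul_left_comm _ ((M : 𝕜) ^ M)⁻¹] at hscale
  rw [← mul_sum] at hscale
  have hbound := norm_polarized_le (P := P) (n := n) (b := b) (y := fun i k => ∑ j : Fin N,
    ((M : 𝕜)⁻¹ * x (e ⟨i, k⟩) j) •
      (lp.single (ENNReal.ofReal p) (j : ℕ) 1 : EllP 𝕜 (ENNReal.ofReal p))) (fun S => by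
    refine hPb _ fun i => (norm_sum_le _ _).trans ?_
    have hy : ∀ k : Fin (n i), ‖∑ j : Fin N, ((M : 𝕜)⁻¹ * x (e ⟨i, k⟩) j) •
        (lp.single (ENNReal.ofReal p) (j : ℕ) 1 : EllP 𝕜 (ENNReal.ofReal p))‖ ≤ (M : ℝ)⁻¹ := by
      intro k
      refine norm_sum_smul_single_le hp0 _ (by positivity) ?_
      simp only [norm_mul, norm_inv, RCLike.norm_natCast,
        Real.mul_rpow (inv_nonneg.2 (Nat.cast_nonneg M)) (norm_nonneg _)]
      rw [← mul_sum]
      exact mul_le_of_le_one_right (by positivity) (hx _)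
    refine (sum_le_sum fun k _ => hy k).trans ?_
    rw [sum_const, nsmul_eq_mul, mul_inv_le_iff₀ (by positivity), one_mul]
    have h1 : #(S i) ≤ n i := (card_le_univ _).trans (by simp)
    have h2 : n i ≤ M := hM ▸ single_le_sum (fun _ _ => Nat.zero_le _) (mem_univ i)
    exact_mod_cast h1.trans h2)
  rw [hscale, norm_mul, norm_inv, norm_pow, RCLike.norm_natCast,
    inv_mul_le_iff₀ (by positivity), ← hM] at hbound
  refine hbound.trans (le_of_eq ?_)
  rw [mul_pow]
  ring

/-- Bound for finitely many monomial coefficients. Each is a sum of a bounded number of coefficients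
of the polarization, and no tuple of indices contributes to two of them. -/
theorem IsMultiPoly.sum_norm_monomCoeff_rpow_le {m : ℕ} {n : Fin m → ℕ} {M : ℕ}
    (hM : M = ∑ i, n i) (hM1 : 1 ≤ M) {p s b : ℝ} (hp : 2 * (M : ℝ) ≤ p) (hs0 : 0 < s)
    (hs : 2 * M * p / (M * p + p - 2 * M) ≤ s) (hb : 0 < b)
    {P : (Fin m → EllP 𝕜 (ENNReal.ofReal p)) → 𝕜} (hP : IsMultiPoly 𝕜 n P)
    (hPb : ∀ x, (∀ i, ‖x i‖ ≤ 1) → ‖P x‖ ≤ b) (F : Finset (MultiIdx n)) :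
    ∑ α ∈ F, ‖monomCoeff hP α‖ ^ s
      ≤ ((∏ i, n i ^ n i : ℕ) * (Real.sqrt 3 ^ M * ((2 * M) ^ M * b))) ^ s := by
  classical
  let D : (∀ i, Fin (n i) → ℕ) → 𝕜 := fun J =>
    polarized n P (fun i k => lp.single (ENNReal.ofReal p) (J i k) 1)
  set W : ℝ := ((∏ i, n i ^ n i : ℕ) : ℝ) with hW
  obtain ⟨N, hN⟩ : ∃ N : ℕ, ∀ α ∈ F, ∀ i, ∀ j ∈ (α.1 i).support, j < N := by
    refine ⟨(F.sup fun α => univ.sup fun i => (α.1 i).support.sup id) + 1, fun α hα i j hj => ?_⟩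
    have h1 : j ≤ (α.1 i).support.sup id := le_sup (f := id) hj
    have h2 : (α.1 i).support.sup id ≤ univ.sup fun i => (α.1 i).support.sup id :=
      le_sup (f := fun i => (α.1 i).support.sup id) (mem_univ i)
    have h3 := le_sup (f := fun α : MultiIdx n => univ.sup fun i => (α.1 i).support.sup id) hα
    exact Nat.lt_succ_of_le (h1.trans (h2.trans h3))
  have hpt : ∀ α, ‖monomCoeff hP α‖ ^ s ≤ W ^ s * ∑ J ∈ tupleFiber α, ‖D J‖ ^ s := by
    intro α
    rw [hP.monomCoeff_eq α]
    rcases (tupleFiber α).eq_empty_or_nonempty with h0 | hne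
    · simp [h0, Real.zero_rpow hs0.ne']
    obtain ⟨J₀, hJ₀, hmax⟩ := exists_max_image (tupleFiber α) (fun J => ‖D J‖) hne
    have h1 : ‖∑ J ∈ tupleFiber α, D J‖ ≤ W * ‖D J₀‖ := by
      refine (norm_sum_le_of_le _ hmax).trans ?_
      rw [sum_const, nsmul_eq_mul]
      gcongr
      rw [hW]
      exact_mod_cast card_tupleFiber_le α
    calc _ ≤ (W * ‖D J₀‖) ^ s := Real.rpow_le_rpow (norm_nonneg _) h1 hs0.le
      _ = W ^ s * ‖D J₀‖ ^ s := Real.mul_rpow (Nat.cast_nonneg _) (norm_nonneg _)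
      _ ≤ _ := by
        gcongr
        exact single_le_sum (f := fun J => ‖D J‖ ^ s)
          (fun J _ => Real.rpow_nonneg (norm_nonneg _) _) hJ₀
  let ι : (∀ i, Fin (n i) → Fin N) → (∀ i, Fin (n i) → ℕ) := fun J i k => J i k
  have hι : Function.Injective ι := fun J J' h =>
    funext fun i => funext fun k => Fin.ext (congrFun (congrFun h i) k)
  have hdisj : ∑ α ∈ F, ∑ J ∈ tupleFiber α, ‖D J‖ ^ s
      = ∑ J ∈ F.biUnion tupleFiber, ‖D J‖ ^ s := by
    refine (sum_biUnion fun α _ β _ hαβ => ?_).symm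
    refine disjoint_left.2 fun J hJ hJ' => hαβ ?_
    rw [← mem_tupleFiber.1 hJ, ← mem_tupleFiber.1 hJ']
  have hsub : F.biUnion tupleFiber ⊆ univ.image ι := by
    intro J hJ
    obtain ⟨α, hα, hJα⟩ := mem_biUnion.1 hJ
    exact mem_image.2 ⟨fun i k => ⟨J i k, hN α hα i _
      (mem_support_of_tupleIdx_eq (mem_tupleFiber.1 hJα) i k)⟩, mem_univ _, rfl⟩
  calc _ ≤ ∑ α ∈ F, W ^ s * ∑ J ∈ tupleFiber α, ‖D J‖ ^ s := sum_le_sum fun α _ => hpt α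
    _ = W ^ s * ∑ J ∈ F.biUnion tupleFiber, ‖D J‖ ^ s := by rw [← mul_sum, hdisj]
    _ ≤ W ^ s * ∑ J ∈ univ.image ι, ‖D J‖ ^ s := by
        gcongr
    _ = W ^ s * ∑ J, ‖D (ι J)‖ ^ s := by rw [sum_image fun _ _ _ _ h => hι h]
    _ ≤ W ^ s * (Real.sqrt 3 ^ M * ((2 * M) ^ M * b)) ^ s := by
        gcongr
        exact hP.sum_norm_polarized_rpow_le hM hM1 hp hs hb hPb N
    _ = _ := (Real.mul_rpow (Nat.cast_nonneg _) (by positivity)).symm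

/-- The Hardy–Littlewood inequality for the monomial coefficients of multihomogeneous
polynomials. -/
theorem exists_monomCoeff_bound {m : ℕ} {n : Fin m → ℕ} {M : ℕ}
    (hM : M = ∑ i, n i) (hM1 : 1 ≤ M) {p s : ℝ} (hp : 2 * (M : ℝ) ≤ p) (hs0 : 0 < s)
    (hs : 2 * M * p / (M * p + p - 2 * M) ≤ s) :
    ∃ C : ℝ, 1 ≤ C ∧
      ∀ (P : (Fin m → EllP 𝕜 (ENNReal.ofReal p)) → 𝕜) (hP : IsMultiPoly 𝕜 n P),
        (∑' α : MultiIdx n, ‖monomCoeff hP α‖ₑ ^ s) ^ (1 / s)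
          ≤ ENNReal.ofReal C * multiPolyNorm P := by
  set C₀ : ℝ := (∏ i, n i ^ n i : ℕ) * (Real.sqrt 3 ^ M * (2 * M) ^ M) with hC₀
  have hC₀0 : 0 ≤ C₀ := by positivity
  refine ⟨max 1 C₀, le_max_left _ _, fun P hP => ?_⟩
  set C := max 1 C₀ with hC
  have hC1 : 1 ≤ C := le_max_left _ _
  rcases eq_or_ne (multiPolyNorm P) ∞ with htop | hfin
  · rw [htop, ENNReal.mul_top (by simp; linarith)]
    exact le_top
  have key : ∀ b : ℝ, 0 < b → multiPolyNorm P ≤ ENNReal.ofReal b →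
      (∑' α : MultiIdx n, ‖monomCoeff hP α‖ₑ ^ s) ^ (1 / s) ≤ ENNReal.ofReal (C * b) := by
    intro b hb hPb
    have hPb' : ∀ x, (∀ i, ‖x i‖ ≤ 1) → ‖P x‖ ≤ b := by
      intro x hx
      have h1 : ‖P x‖ₑ ≤ multiPolyNorm P := le_iSup₂_of_le x hx le_rfl
      have h2 := h1.trans hPb
      rwa [← ofReal_norm, ENNReal.ofReal_le_ofReal_iff hb.le] at h2
    rw [one_div, ENNReal.rpow_inv_le_iff hs0, ENNReal.tsum_eq_iSup_sum]
    refine iSup_le fun F => ?_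
    have h1 := hP.sum_norm_monomCoeff_rpow_le hM hM1 hp hs0 hs hb hPb' F
    have h2 : ∑ α ∈ F, ‖monomCoeff hP α‖ₑ ^ s
        = ENNReal.ofReal (∑ α ∈ F, ‖monomCoeff hP α‖ ^ s) := by
      rw [ENNReal.ofReal_sum_of_nonneg fun α _ => Real.rpow_nonneg (norm_nonneg _) _]
      refine sum_congr rfl fun α _ => ?_
      rw [← ofReal_norm, ENNReal.ofReal_rpow_of_nonneg (norm_nonneg _) hs0.le]
    rw [h2, ENNReal.ofReal_rpow_of_nonneg (by positivity) hs0.le]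
    refine ENNReal.ofReal_le_ofReal (h1.trans ?_)
    refine Real.rpow_le_rpow (by positivity) ?_ hs0.le
    calc _ = C₀ * b := by rw [hC₀]; ring
      _ ≤ C * b := by
        gcongr
        exact le_max_right _ _
  -- `key` needs a positive bound, while the norm of `P` may vanish
  refine ENNReal.le_of_forall_pos_le_add fun ε hε _ => ?_
  have hC0 : 0 < C := by linarith
  have hε' : (0 : ℝ) < ε := hε
  have h1 := key ((multiPolyNorm P).toReal + ε / C) (by positivity) (by
    rw [ENNReal.ofReal_add ENNReal.toReal_nonneg (by positivity), ENNReal.ofReal_toReal hfin]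
    exact le_self_add)
  refine h1.trans (le_of_eq ?_)
  rw [mul_add, mul_div_cancel₀ _ hC0.ne', ENNReal.ofReal_add (by positivity) hε'.le,
    ENNReal.ofReal_mul hC0.le, ENNReal.ofReal_toReal hfin, ENNReal.ofReal_coe_nnreal]

end Upper

/-! ### Random sign forms of small norm -/

section RandomSigns

open Finset
open scoped BigOperators

theorem sum_exp_signs_le {𝒥 : Type*} [Fintype 𝒥] [DecidableEq 𝒥] (v : 𝒥 → ℝ) :
    ∑ ε : 𝒥 → Bool, Real.exp (∑ J, boolSign ℝ (ε J) * v J)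
      ≤ 2 ^ Fintype.card 𝒥 * Real.exp ((∑ J, v J ^ 2) / 2) := by
  have h1 : ∑ ε : 𝒥 → Bool, Real.exp (∑ J, boolSign ℝ (ε J) * v J)
      = ∏ J, (2 * Real.cosh (v J)) := by
    simp only [Real.exp_sum]
    have := prod_univ_sum (fun _ : 𝒥 => (univ : Finset Bool))
      (fun J b => Real.exp (boolSign ℝ b * v J))
    rw [Fintype.piFinset_univ] at this
    rw [← this]
    refine prod_congr rfl fun J _ => ?_
    rw [Real.cosh_eq]
    simp [boolSign]
    ring
  rw [h1, prod_mul_distrib, prod_const, card_univ, sum_div, Real.exp_sum]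
  gcongr with J _
  exact Real.cosh_le_exp_half_sq _

/-- Signs for which finitely many linear forms are simultaneously small: Chernoff's method with
parameter `t` and a union bound. -/
theorem exists_signs_bound {𝒥 γ : Type*} [Fintype 𝒥] [DecidableEq 𝒥] [Fintype γ] (v : γ → 𝒥 → ℝ)
    {V t : ℝ} (hv : ∀ g, ∑ J, v g J ^ 2 ≤ V) (ht : 0 < t) :
    ∃ ε : 𝒥 → Bool, ∀ g, |∑ J, boolSign ℝ (ε J) * v g J|
      ≤ Real.log (2 * Fintype.card γ) / t + t * V / 2 := by
  have hone : ∀ (r : ℝ) (g : γ), r ^ 2 = t ^ 2 →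
      ∑ ε : 𝒥 → Bool, Real.exp (r * ∑ J, boolSign ℝ (ε J) * v g J)
        ≤ 2 ^ Fintype.card 𝒥 * Real.exp (t ^ 2 * V / 2) := by
    intro r g hr
    have h := sum_exp_signs_le (fun J => r * v g J)
    simp only [mul_left_comm _ r, ← mul_sum, mul_pow, hr] at h
    refine h.trans ?_
    have := hv g
    gcongr
  have hcard : ∑ _ε : 𝒥 → Bool, (1 : ℝ) = 2 ^ Fintype.card 𝒥 := by simp
  have hsum : ∑ ε : 𝒥 → Bool, ∑ g, (Real.exp (t * ∑ J, boolSign ℝ (ε J) * v g J) +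
      Real.exp (-t * ∑ J, boolSign ℝ (ε J) * v g J))
        ≤ ∑ _ε : 𝒥 → Bool, 2 * Fintype.card γ * Real.exp (t ^ 2 * V / 2) := by
    rw [sum_comm]
    simp only [sum_add_distrib]
    calc _ ≤ ∑ _g : γ, 2 ^ Fintype.card 𝒥 * Real.exp (t ^ 2 * V / 2) +
          ∑ _g : γ, 2 ^ Fintype.card 𝒥 * Real.exp (t ^ 2 * V / 2) :=
          add_le_add (sum_le_sum fun g _ => hone t g rfl)
            (sum_le_sum fun g _ => hone (-t) g (neg_sq t))
      _ = _ := by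
          simp
          ring
  obtain ⟨ε, -, hε⟩ := exists_le_of_sum_le univ_nonempty hsum
  refine ⟨ε, fun g => ?_⟩
  set f := ∑ J, boolSign ℝ (ε J) * v g J with hf
  have hγ : (0 : ℝ) < 2 * Fintype.card γ := by
    have : 0 < Fintype.card γ := Fintype.card_pos_iff.2 ⟨g⟩
    positivity
  have hexp : Real.exp (t * |f|) ≤ 2 * Fintype.card γ * Real.exp (t ^ 2 * V / 2) := by
    refine le_trans ?_ ((single_le_sum (f := fun g =>
      Real.exp (t * ∑ J, boolSign ℝ (ε J) * v g J) +
      Real.exp (-t * ∑ J, boolSign ℝ (ε J) * v g J)) (fun _ _ => by positivity)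
      (mem_univ g)).trans hε)
    rcases abs_cases f with ⟨h, _⟩ | ⟨h, _⟩ <;> rw [h]
    · exact le_add_of_nonneg_right (Real.exp_pos _).le
    · rw [mul_neg, ← neg_mul]
      exact le_add_of_nonneg_left (Real.exp_pos _).le
  have hlog := (Real.le_log_iff_exp_le (by positivity)).2 hexp
  rw [Real.log_mul hγ.ne' (Real.exp_pos _).ne', Real.log_exp] at hlog
  have e : Real.log (2 * Fintype.card γ) / t + t * V / 2
      = (Real.log (2 * Fintype.card γ) + t ^ 2 * V / 2) / t := by
    field_simp
  rw [e, le_div_iff₀ ht, mul_comm]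
  exact hlog

theorem abs_prod_sub_prod_le {κ : Type*} (s : Finset κ) (x y : κ → ℝ) {δ : ℝ}
    (hx : ∀ l, |x l| ≤ 1) (hy : ∀ l, |y l| ≤ 1) (hxy : ∀ l, |x l - y l| ≤ δ) :
    |∏ l ∈ s, x l - ∏ l ∈ s, y l| ≤ #s * δ := by
  classical
  induction s using Finset.induction_on with
  | empty => simp
  | insert l s hl ih =>
    rw [prod_insert hl, prod_insert hl, card_insert_of_notMem hl]
    have e : x l * ∏ l ∈ s, x l - y l * ∏ l ∈ s, y l
        = x l * (∏ l ∈ s, x l - ∏ l ∈ s, y l) + (x l - y l) * ∏ l ∈ s, y l := by ring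
    have h1 : |∏ l ∈ s, y l| ≤ 1 := by
      rw [abs_prod]
      exact prod_le_one (fun _ _ => abs_nonneg _) fun l _ => hy l
    rw [e]
    refine (abs_add_le _ _).trans ?_
    rw [abs_mul, abs_mul]
    have h2 : |x l| * |∏ l ∈ s, x l - ∏ l ∈ s, y l| ≤ 1 * (#s * δ) := by
      gcongr
      exact hx l
    have h3 : |x l - y l| * |∏ l ∈ s, y l| ≤ δ * 1 := by
      gcongr
      · exact (abs_nonneg _).trans (hxy l)
      · exact hxy l
    push_cast
    linarith

theorem sum_prod_sq {κ : Type*} [Fintype κ] [DecidableEq κ] {N : ℕ} (x : κ → Fin N → ℝ) :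
    ∑ J : κ → Fin N, (∏ l, x l (J l)) ^ 2 = ∏ l, ∑ j, x l j ^ 2 := by
  rw [prod_univ_sum, Fintype.piFinset_univ]
  simp only [prod_pow]

/-- Signs for which the multilinear form with these coefficients is small on products of Euclidean
balls. The union bound runs over the points with coordinates in the grid `{-1, …, -1/K, 0, 1/K, …, 1}`
(and Euclidean norm at most `2`); the last summand is the error of rounding to the grid. -/
theorem exists_signs_multilinear_le {κ : Type*} [Fintype κ] [DecidableEq κ] {N K : ℕ} (hN : 1 ≤ N)
    (hNK : N ≤ K) :
    ∃ ε : (κ → Fin N) → Bool, ∀ x : κ → Fin N → ℝ, (∀ l, ∑ j, x l j ^ 2 ≤ 1) →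
      |∑ J, boolSign ℝ (ε J) * ∏ l, x l (J l)|
        ≤ Real.log (2 * (2 * K + 1) ^ (N * Fintype.card κ)) / Real.sqrt N +
          Real.sqrt N * 4 ^ Fintype.card κ / 2 + N ^ Fintype.card κ * (Fintype.card κ / K) := by
  classical
  have hK : (0 : ℝ) < K := by exact_mod_cast hN.trans hNK
  have hN' : (0 : ℝ) < N := by exact_mod_cast hN
  have hNK' : (N : ℝ) ≤ K := by exact_mod_cast hNK
  have hN1 : (1 : ℝ) ≤ N := by exact_mod_cast hN
  let val : Fin (2 * K + 1) → ℝ := fun c => ((c : ℕ) - (K : ℝ)) / K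
  -- grid points far from the ball contribute the zero form, which does no harm to the union bound
  let v : (κ → Fin N → Fin (2 * K + 1)) → (κ → Fin N) → ℝ := fun c J =>
    if ∀ l, ∑ j, val (c l j) ^ 2 ≤ 4 then ∏ l, val (c l (J l)) else 0
  obtain ⟨ε, hε⟩ := exists_signs_bound v (V := 4 ^ Fintype.card κ) (t := Real.sqrt N) (fun c => by
    by_cases h : ∀ l, ∑ j, val (c l j) ^ 2 ≤ 4
    · simp only [v, h, implies_true, if_true]
      rw [sum_prod_sq (fun l j => val (c l j))]
      refine (prod_le_prod (fun l _ => sum_nonneg fun _ _ => sq_nonneg _) fun l _ => h l).trans ?_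
      simp
    · simp only [v, h, if_false]
      simp) (Real.sqrt_pos.2 hN')
  refine ⟨ε, fun x hx => ?_⟩
  have hx1 : ∀ l j, |x l j| ≤ 1 := by
    intro l j
    have := (single_le_sum (f := fun j => x l j ^ 2) (fun _ _ => sq_nonneg _) (mem_univ j)).trans
      (hx l)
    exact (sq_le_one_iff_abs_le_one _).1 this
  have hround : ∀ l j, ∃ c : Fin (2 * K + 1), |x l j - val c| ≤ 1 / K ∧ |val c| ≤ 1 := by
    intro l j
    have h1 := abs_le.1 (hx1 l j)
    have hf1 : -(K : ℤ) ≤ ⌊x l j * K⌋ := by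
      rw [Int.le_floor]
      push_cast
      nlinarith
    have hf2 : ⌊x l j * K⌋ ≤ (K : ℤ) := by
      have : (⌊x l j * K⌋ : ℝ) ≤ K := (Int.floor_le _).trans (by nlinarith)
      exact_mod_cast this
    refine ⟨⟨(⌊x l j * K⌋ + K).toNat, by omega⟩, ?_⟩
    have hval : val ⟨(⌊x l j * K⌋ + K).toNat, by omega⟩ = ⌊x l j * K⌋ / K := by
      have : (((⌊x l j * K⌋ + K).toNat : ℕ) : ℝ) = ⌊x l j * K⌋ + K := by
        have h3 : (((⌊x l j * K⌋ + K).toNat : ℕ) : ℤ) = ⌊x l j * K⌋ + K :=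
          Int.toNat_of_nonneg (by omega)
        exact_mod_cast h3
      simp only [val, this]
      ring
    rw [hval]
    constructor
    · have e : x l j - ⌊x l j * K⌋ / K = Int.fract (x l j * K) / K := by
        rw [Int.fract]
        field_simp
      rw [e, abs_of_nonneg (div_nonneg (Int.fract_nonneg _) hK.le)]
      gcongr
      exact (Int.fract_lt_one _).le
    · rw [abs_div, abs_of_pos hK, div_le_one hK, abs_le]
      exact ⟨by exact_mod_cast hf1, by exact_mod_cast hf2⟩
  choose c hc1 hc2 using hround
  have hcond : ∀ l, ∑ j, val (c l j) ^ 2 ≤ 4 := by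
    intro l
    have hpt : ∀ j, val (c l j) ^ 2 ≤ 2 * x l j ^ 2 + 2 * (1 / K) ^ 2 := by
      intro j
      have h1 : (x l j - val (c l j)) ^ 2 ≤ (1 / (K : ℝ)) ^ 2 := sq_le_sq' (abs_le.1 (hc1 l j)).1
        (abs_le.1 (hc1 l j)).2
      nlinarith [sq_nonneg (2 * x l j - val (c l j))]
    refine (sum_le_sum fun j _ => hpt j).trans ?_
    rw [sum_add_distrib, ← mul_sum]
    simp only [sum_const, card_univ, Fintype.card_fin, nsmul_eq_mul]
    have h2 : (N : ℝ) * (1 / K) ^ 2 ≤ 1 := by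
      rw [one_div, inv_pow, mul_inv_le_iff₀ (by positivity)]
      nlinarith
    have := hx l
    linarith
  have hgrid := hε c
  simp only [v, hcond, implies_true, if_true] at hgrid
  simp only [Fintype.card_fun, Fintype.card_fin] at hgrid
  rw [← pow_mul] at hgrid
  push_cast at hgrid
  have hdiff : |∑ J, boolSign ℝ (ε J) * ∏ l, x l (J l) -
      ∑ J, boolSign ℝ (ε J) * ∏ l, val (c l (J l))|
        ≤ N ^ Fintype.card κ * (Fintype.card κ / K) := by
    rw [← sum_sub_distrib]
    refine (abs_sum_le_sum_abs _ _).trans ?_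
    have hpt : ∀ J : κ → Fin N, |boolSign ℝ (ε J) * ∏ l, x l (J l) -
        boolSign ℝ (ε J) * ∏ l, val (c l (J l))| ≤ Fintype.card κ / K := by
      intro J
      rw [← mul_sub, abs_mul, ← Real.norm_eq_abs (boolSign ℝ _), norm_boolSign, one_mul]
      refine (abs_prod_sub_prod_le univ _ _ (fun l => hx1 l (J l)) (fun l => hc2 l (J l))
        (fun l => hc1 l (J l))).trans (le_of_eq ?_)
      rw [card_univ]
      ring
    refine (sum_le_sum fun J _ => hpt J).trans (le_of_eq ?_)
    simp
  have htri := abs_sub_abs_le_abs_sub (∑ J, boolSign ℝ (ε J) * ∏ l, x l (J l))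
    (∑ J, boolSign ℝ (ε J) * ∏ l, val (c l (J l)))
  linarith

/-- Random signs give multilinear forms of norm `O(√N log N)` on Euclidean balls. -/
theorem exists_signs_multilinear_le_log (κ : Type*) [Fintype κ] [DecidableEq κ] [Nonempty κ] :
    ∃ A : ℝ, 0 < A ∧ ∀ N : ℕ, 1 ≤ N → ∃ ε : (κ → Fin N) → Bool,
      ∀ x : κ → Fin N → ℝ, (∀ l, ∑ j, x l j ^ 2 ≤ 1) →
        |∑ J, boolSign ℝ (ε J) * ∏ l, x l (J l)| ≤ A * (Real.sqrt N * (1 + Real.log N)) := by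
  set M := Fintype.card κ with hM
  have hM1 : 1 ≤ M := Fintype.card_pos
  have hM1' : (1 : ℝ) ≤ M := by exact_mod_cast hM1
  have hlogM : 0 ≤ Real.log (3 * M) := Real.log_nonneg (by linarith)
  refine ⟨2 * M * (Real.log (3 * M) + M) + 4 ^ M / 2 + 1, by positivity, fun N hN => ?_⟩
  have hN1 : (1 : ℝ) ≤ N := by exact_mod_cast hN
  -- `K = M N^M` makes the rounding error equal to `1`
  obtain ⟨ε, hε⟩ := exists_signs_multilinear_le (κ := κ) (N := N) (K := M * N ^ M) hN
    ((Nat.le_self_pow (by omega) N).trans (Nat.le_mul_of_pos_left _ hM1))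
  refine ⟨ε, fun x hx => (hε x hx).trans ?_⟩
  rw [← hM]
  have hL : 0 ≤ Real.log N := Real.log_nonneg hN1
  have hsq : 1 ≤ Real.sqrt N := Real.one_le_sqrt.2 hN1
  have hsq0 : 0 < Real.sqrt N := by linarith
  have hK1 : (1 : ℝ) ≤ M * (N : ℝ) ^ M := one_le_mul_of_one_le_of_one_le hM1' (one_le_pow₀ hN1)
  have hlog : Real.log (2 * (2 * ((M * N ^ M : ℕ) : ℝ) + 1) ^ (N * M))
      ≤ N * (2 * M * (Real.log (3 * M) + M * Real.log N)) := by
    push_cast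
    have h3K : Real.log (3 * (M * (N : ℝ) ^ M)) = Real.log (3 * M) + M * Real.log N := by
      rw [← mul_assoc, Real.log_mul (by positivity) (by positivity), Real.log_pow]
    have hNM : 1 ≤ (N : ℝ) * M := one_le_mul_of_one_le_of_one_le hN1 hM1'
    have h3 : 0 ≤ Real.log (3 * (M * (N : ℝ) ^ M)) := Real.log_nonneg (by linarith)
    rw [Real.log_mul two_ne_zero (by positivity), Real.log_pow, ← h3K]
    have h1 : Real.log 2 ≤ Real.log (3 * (M * (N : ℝ) ^ M)) :=
      Real.log_le_log two_pos (by linarith)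
    have h2 : Real.log (2 * (M * (N : ℝ) ^ M) + 1) ≤ Real.log (3 * (M * (N : ℝ) ^ M)) :=
      Real.log_le_log (by positivity) (by linarith)
    push_cast
    have h4 : (N : ℝ) * M * Real.log (2 * (M * (N : ℝ) ^ M) + 1)
        ≤ N * M * Real.log (3 * (M * (N : ℝ) ^ M)) := by gcongr
    nlinarith
  have hfirst : Real.log (2 * (2 * ((M * N ^ M : ℕ) : ℝ) + 1) ^ (N * M)) / Real.sqrt N
      ≤ Real.sqrt N * (2 * M * (Real.log (3 * M) + M * Real.log N)) := by
    rw [div_le_iff₀ hsq0]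
    refine hlog.trans (le_of_eq ?_)
    nth_rewrite 1 [← Real.mul_self_sqrt (Nat.cast_nonneg N : (0 : ℝ) ≤ N)]
    ring
  have hlast : (N : ℝ) ^ M * (M / ((M * N ^ M : ℕ) : ℝ)) = 1 := by
    push_cast
    have : (M : ℝ) ≠ 0 := by positivity
    field_simp
  rw [hlast]
  calc _ ≤ Real.sqrt N * (2 * M * (Real.log (3 * M) + M * Real.log N)) +
        Real.sqrt N * 4 ^ M / 2 + Real.sqrt N * 1 := by linarith
    _ = Real.sqrt N * (2 * M * (Real.log (3 * M) + M * Real.log N) + 4 ^ M / 2 + 1) := by ring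
    _ ≤ Real.sqrt N * ((2 * M * (Real.log (3 * M) + M) + 4 ^ M / 2 + 1) * (1 + Real.log N)) := by
        refine mul_le_mul_of_nonneg_left ?_ hsq0.le
        have e1 : 0 ≤ 2 * M * Real.log (3 * M) * Real.log N := by positivity
        have e2 : 0 ≤ (4 : ℝ) ^ M / 2 * Real.log N := by positivity
        nlinarith
    _ = _ := by ring

/-- Random signs give multilinear forms of small norm on products of balls of real or complex `ℓ_p`,
`p ≥ 2`: the `ℓ_2` norm is at most `N^(1/2-1/p)` times the `ℓ_p` norm, and complex vectors are split
into real and imaginary parts. -/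
theorem exists_signs_multilinear_ellP_le (𝕜 : Type*) [RCLike 𝕜] (κ : Type*) [Fintype κ]
    [DecidableEq κ] [Nonempty κ] {p : ℝ} (hp : 2 ≤ p) :
    ∃ A : ℝ, 0 < A ∧ ∀ N : ℕ, 1 ≤ N → ∃ ε : (κ → Fin N) → Bool,
      ∀ z : κ → Fin N → 𝕜, (∀ l, ∑ j, ‖z l j‖ ^ p ≤ 1) →
        ‖∑ J, boolSign 𝕜 (ε J) * ∏ l, z l (J l)‖ ≤
          A * (1 + Real.log N) * (N : ℝ) ^ (1 / 2 + Fintype.card κ * (1 / 2 - 1 / p)) := by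
  obtain ⟨A, hA, h⟩ := exists_signs_multilinear_le_log κ
  refine ⟨2 ^ Fintype.card κ * A, by positivity, fun N hN => ?_⟩
  obtain ⟨ε, hε⟩ := h N hN
  refine ⟨ε, fun z hz => ?_⟩
  have hN1 : (1 : ℝ) ≤ N := by exact_mod_cast hN
  have hN0 : (0 : ℝ) < N := by linarith
  have hp0 : 0 < p := by linarith
  set h := (N : ℝ) ^ (1 / 2 - 1 / p) with hh
  have hh0 : 0 < h := Real.rpow_pos_of_pos hN0 _
  have hl2 : ∀ l, ∑ j, ‖z l j‖ ^ 2 ≤ h ^ 2 := by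
    intro l
    have hw := Real.inner_le_weight_mul_Lp_of_nonneg (univ : Finset (Fin N)) (p := p / 2)
      (by linarith) (fun _ => 1) (fun j => ‖z l j‖ ^ 2) (fun _ => zero_le_one)
      (fun j => sq_nonneg _)
    simp only [one_mul, sum_const, card_univ, Fintype.card_fin, nsmul_eq_mul, mul_one] at hw
    have e : ∀ j, (‖z l j‖ ^ 2) ^ (p / 2) = ‖z l j‖ ^ p := by
      intro j
      rw [← Real.rpow_natCast, ← Real.rpow_mul (norm_nonneg _)]
      congr 1
      push_cast
      ring
    simp only [e] at hw
    refine hw.trans ?_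
    have h1 : (∑ j, ‖z l j‖ ^ p) ^ (p / 2)⁻¹ ≤ 1 :=
      Real.rpow_le_one (by positivity) (hz l) (by positivity)
    refine (mul_le_of_le_one_right (by positivity) h1).trans (le_of_eq ?_)
    rw [hh, ← Real.rpow_natCast, ← Real.rpow_mul hN0.le]
    congr 1
    push_cast
    field_simp
  let w : Bool → κ → Fin N → ℝ := fun b l j =>
    (if b then RCLike.re (z l j) else RCLike.im (z l j)) / h
  let u : Bool → 𝕜 := fun b => (if b then 1 else RCLike.I) * (h : 𝕜)
  have hw : ∀ b l, ∑ j, w b l j ^ 2 ≤ 1 := by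
    intro b l
    simp only [w, div_pow, ← sum_div]
    rw [div_le_one (by positivity)]
    refine (sum_le_sum fun j _ => ?_).trans (hl2 l)
    refine sq_le_sq.2 ?_
    rw [abs_of_nonneg (norm_nonneg (z l j))]
    split_ifs
    · exact RCLike.abs_re_le_norm _
    · exact RCLike.abs_im_le_norm _
  have hu : ∀ b, ‖u b‖ ≤ h := by
    intro b
    simp only [u, norm_mul, RCLike.norm_ofReal, abs_of_pos hh0]
    refine mul_le_of_le_one_left hh0.le ?_
    split_ifs
    · simp
    · by_cases hI : (RCLike.I : 𝕜) = 0
      · simp [hI]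
      · exact (RCLike.norm_I_of_ne_zero hI).le
  have hzw : ∀ l j, z l j = ∑ b, u b * (w b l j : 𝕜) := by
    intro l j
    have hne : (h : 𝕜) ≠ 0 := by exact_mod_cast hh0.ne'
    simp only [Fintype.sum_bool, u, w, if_true, Bool.false_eq_true, if_false, RCLike.ofReal_div]
    rw [one_mul, mul_div_cancel₀ _ hne, mul_assoc, mul_div_cancel₀ _ hne, mul_comm RCLike.I]
    exact (RCLike.re_add_im _).symm
  have hexpand : ∑ J, boolSign 𝕜 (ε J) * ∏ l, z l (J l) = ∑ b : κ → Bool, (∏ l, u (b l)) *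
      ((∑ J, boolSign ℝ (ε J) * ∏ l, w (b l) l (J l) : ℝ) : 𝕜) := by
    have hsg : ∀ b, boolSign 𝕜 b = ((boolSign ℝ b : ℝ) : 𝕜) := by
      intro b
      cases b <;> simp [boolSign]
    simp only [RCLike.ofReal_sum, RCLike.ofReal_mul, RCLike.ofReal_prod, mul_sum, hsg]
    rw [sum_comm]
    refine sum_congr rfl fun J _ => ?_
    simp only [hzw]
    rw [prod_univ_sum, Fintype.piFinset_univ, mul_sum]
    refine sum_congr rfl fun b _ => ?_
    rw [prod_mul_distrib]
    ring
  rw [hexpand]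
  have hpt : ∀ b : κ → Bool, ‖(∏ l, u (b l)) *
      ((∑ J, boolSign ℝ (ε J) * ∏ l, w (b l) l (J l) : ℝ) : 𝕜)‖
        ≤ h ^ Fintype.card κ * (A * (Real.sqrt N * (1 + Real.log N))) := by
    intro b
    rw [norm_mul, RCLike.norm_ofReal, norm_prod]
    refine mul_le_mul ?_ (hε _ fun l => hw (b l) l) (abs_nonneg _) (by positivity)
    refine (prod_le_prod (fun _ _ => norm_nonneg _) fun l _ => hu (b l)).trans (le_of_eq ?_)
    simp
  refine (norm_sum_le_of_le _ fun b _ => hpt b).trans (le_of_eq ?_)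
  have hpow : (N : ℝ) ^ (1 / 2 + Fintype.card κ * (1 / 2 - 1 / p))
      = Real.sqrt N * h ^ Fintype.card κ := by
    rw [Real.rpow_add hN0, ← Real.sqrt_eq_rpow, hh, ← Real.rpow_natCast, ← Real.rpow_mul hN0.le,
      mul_comm (1 / 2 - 1 / p)]
  rw [hpow]
  simp only [sum_const, card_univ, Fintype.card_fun, Fintype.card_bool, nsmul_eq_mul]
  push_cast
  ring

end RandomSigns

/-! ### Optimality of the exponent -/

section Lower

open Finset Filter Asymptotics

variable {𝕜 : Type*} [RCLike 𝕜]

/-- The multihomogeneous polynomial obtained from the multilinear form with coefficients `a` by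
placing the variables of the `i`-th group on disjoint blocks of coordinates of the `i`-th
variable, the `k`-th block being `{Nat.pair k j | j}`. -/
def blockPoly {m : ℕ} (n : Fin m → ℕ) (p : ℝ≥0∞) {N : ℕ}
    (a : ((Σ i, Fin (n i)) → Fin N) → 𝕜) (x : Fin m → EllP 𝕜 p) : 𝕜 :=
  ∑ J, a J * ∏ i, ∏ k : Fin (n i), x i (Nat.pair k (J ⟨i, k⟩))

theorem isMultiPoly_blockPoly {m : ℕ} (n : Fin m → ℕ) (p : ℝ≥0∞) {N : ℕ}
    (a : ((Σ i, Fin (n i)) → Fin N) → 𝕜) : IsMultiPoly 𝕜 n (blockPoly n p a) := by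
  intro i x
  refine ⟨∑ J, (a J * ∏ l ∈ {i}ᶜ, ∏ k : Fin (n l), x l (Nat.pair k (J ⟨l, k⟩))) •
    (MultilinearMap.mkPiAlgebra 𝕜 (Fin (n i)) 𝕜).compLinearMap
      (fun k => lp.evalₗ (𝕜 := 𝕜) (fun _ : ℕ => 𝕜) p (Nat.pair k (J ⟨i, k⟩))), fun y => ?_⟩
  rw [_root_.sum_apply]
  refine sum_congr rfl fun J _ => ?_
  rw [Fintype.prod_eq_mul_prod_compl i, Function.update_self]
  have e : ∏ l ∈ {i}ᶜ, ∏ k : Fin (n l), Function.update x i y l (Nat.pair k (J ⟨l, k⟩))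
      = ∏ l ∈ {i}ᶜ, ∏ k : Fin (n l), x l (Nat.pair k (J ⟨l, k⟩)) := by
    refine prod_congr rfl fun l hl => ?_
    rw [Function.update_of_ne (by simpa using hl)]
  rw [e]
  simp only [smul_apply, MultilinearMap.compLinearMap_apply,
    MultilinearMap.mkPiAlgebra_apply, smul_eq_mul]
  change _ = a J * _ * ∏ k : Fin (n i), y (Nat.pair k (J ⟨i, k⟩))
  ring

/-- The multi-index of the monomial that belongs to the tuple `J` in `blockPoly`. -/
noncomputable def blockIdx {m : ℕ} (n : Fin m → ℕ) {N : ℕ} (J : (Σ i, Fin (n i)) → Fin N) :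
    MultiIdx n :=
  tupleIdx fun i k => Nat.pair k (J ⟨i, k⟩)

theorem blockIdx_injective {m : ℕ} (n : Fin m → ℕ) {N : ℕ} :
    Function.Injective (blockIdx n (N := N)) := by
  intro J J' h
  funext ⟨i, k⟩
  have hmem : Nat.pair k (J ⟨i, k⟩) ∈ ((blockIdx n J').1 i).support := by
    rw [← h]
    exact mem_support_of_tupleIdx_eq (J := fun i k => Nat.pair k (J ⟨i, k⟩)) rfl i k
  rw [Finsupp.mem_support_iff] at hmem
  change (∑ k' : Fin (n i), Finsupp.single (Nat.pair k' (J' ⟨i, k'⟩)) 1 : ℕ →₀ ℕ) _ ≠ 0 at hmem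
  rw [Finsupp.finsetSum_apply] at hmem
  obtain ⟨k', -, hk'⟩ := exists_ne_zero_of_sum_ne_zero hmem
  rw [Finsupp.single_apply_ne_zero] at hk'
  have := Nat.pair_eq_pair.1 hk'.1
  have hk : k = k' := Fin.ext this.1
  subst hk
  exact Fin.ext this.2

theorem monomCoeff_blockPoly {m : ℕ} (n : Fin m → ℕ) (p : ℝ≥0∞) {N : ℕ}
    (a : ((Σ i, Fin (n i)) → Fin N) → 𝕜) (J : (Σ i, Fin (n i)) → Fin N) :
    monomCoeff (isMultiPoly_blockPoly n p a) (blockIdx n J) = a J := by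
  classical
  rw [monomCoeff_unique (isMultiPoly_blockPoly n p a)
    (c := fun α => ∑ J, if blockIdx n J = α then a J else 0)]
  · change ∑ J', (if blockIdx n J' = blockIdx n J then a J' else 0) = a J
    rw [sum_eq_single J (fun J' _ hJ' => if_neg fun h => hJ' (blockIdx_injective n h)) (by simp)]
    simp
  · intro x _
    simp only [sum_mul]
    refine hasSum_sum fun J _ => ?_
    have h := hasSum_single (f := fun α => (if blockIdx n J = α then a J else 0) *
      monom α fun i j => x i j) (blockIdx n J) (fun α hα => by simp [hα.symm])
    simpa only [if_true, blockIdx, monom_tupleIdx] using h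

theorem multiPolyNorm_blockPoly_le {m : ℕ} (n : Fin m → ℕ) {p : ℝ} (hp : 0 < p) {N : ℕ}
    (a : ((Σ i, Fin (n i)) → Fin N) → 𝕜) {B : ℝ}
    (ha : ∀ z : (Σ i, Fin (n i)) → Fin N → 𝕜, (∀ l, ∑ j, ‖z l j‖ ^ p ≤ 1) →
      ‖∑ J, a J * ∏ l, z l (J l)‖ ≤ B) :
    multiPolyNorm (blockPoly n (ENNReal.ofReal p) a) ≤ ENNReal.ofReal B := by
  have hpr : (ENNReal.ofReal p).toReal = p := ENNReal.toReal_ofReal hp.le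
  refine iSup₂_le fun x hx => ?_
  rw [← ofReal_norm]
  refine ENNReal.ofReal_le_ofReal ?_
  have h := ha (fun l j => x l.1 (Nat.pair l.2 j)) (fun l => by
    have h1 := lp.sum_rpow_le_norm_rpow (p := ENNReal.ofReal p) (by rwa [hpr]) (x l.1)
      (univ.image fun j : Fin N => Nat.pair l.2 j)
    rw [sum_image fun j _ j' _ hj => Fin.ext (Nat.pair_eq_pair.1 hj).2, hpr] at h1
    exact h1.trans (Real.rpow_le_one (lp.norm_nonneg' _) (hx l.1) hp.le))
  simpa only [Fintype.prod_sigma, blockPoly] using h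

theorem exists_nat_log_lt_rpow {δ : ℝ} (hδ : 0 < δ) (C : ℝ) :
    ∃ N : ℕ, 1 ≤ N ∧ C * (1 + Real.log N) < (N : ℝ) ^ δ := by
  have h1 : (fun x : ℝ => C * (1 + Real.log x)) =o[atTop] fun x => x ^ δ := by
    refine IsLittleO.const_mul_left (IsLittleO.add ?_ (isLittleO_log_rpow_atTop hδ)) C
    refine isLittleO_const_left.2 (Or.inr ?_)
    exact tendsto_norm_atTop_atTop.comp (tendsto_rpow_atTop hδ)
  have h2 := (h1.comp_tendsto tendsto_natCast_atTop_atTop).def (c := 1 / 2) (by norm_num)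
  obtain ⟨N, hN, hN1⟩ := (h2.and (eventually_ge_atTop 1)).exists
  refine ⟨N, hN1, ?_⟩
  have hpos : (0 : ℝ) < (N : ℝ) ^ δ := Real.rpow_pos_of_pos (by exact_mod_cast hN1) _
  simp only [Function.comp_apply, Real.norm_eq_abs, abs_of_pos hpos] at hN
  linarith [le_abs_self (C * (1 + Real.log N))]

/-- Optimality of the exponent: a polynomial with `N ^ M` coefficients of modulus `1` and norm at most
`N ^ (1/2 + M (1/2 - 1/p))` up to a logarithm, for every `N`. -/
theorem exponent_le_of_monomCoeff_bound {m : ℕ} {n : Fin m → ℕ} {M : ℕ} (hM : M = ∑ i, n i)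
    (hM1 : 1 ≤ M) {p s C : ℝ} (hp : 2 * (M : ℝ) ≤ p) (hs : 0 < s) (hC : 1 ≤ C)
    (h : ∀ (P : (Fin m → EllP 𝕜 (ENNReal.ofReal p)) → 𝕜) (hP : IsMultiPoly 𝕜 n P),
      (∑' α : MultiIdx n, ‖monomCoeff hP α‖ₑ ^ s) ^ (1 / s)
        ≤ ENNReal.ofReal C * multiPolyNorm P) :
    2 * M * p / (M * p + p - 2 * M) ≤ s := by
  have hM' : (1 : ℝ) ≤ M := by exact_mod_cast hM1
  have hp0 : 0 < p := by linarith
  have hden : 0 < M * p + p - 2 * M := by nlinarith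
  have hcard : Fintype.card (Σ i, Fin (n i)) = M := by simp [hM]
  have : Nonempty (Σ i, Fin (n i)) := Fintype.card_pos_iff.1 (by omega)
  obtain ⟨A, hA, hsigns⟩ := exists_signs_multilinear_ellP_le 𝕜 (Σ i, Fin (n i)) (p := p)
    (by linarith)
  rw [hcard] at hsigns
  by_contra! hlt
  have hδ : 0 < M / s - (1 / 2 + M * (1 / 2 - 1 / p)) := by
    rw [lt_div_iff₀ hden] at hlt
    have e : M / s - (1 / 2 + M * (1 / 2 - 1 / p))
        = (2 * M * p - s * (M * p + p - 2 * M)) / (2 * s * p) := by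
      field_simp
      ring
    rw [e]
    exact div_pos (by linarith) (by positivity)
  obtain ⟨N, hN, hbig⟩ := exists_nat_log_lt_rpow hδ (C * A)
  have hN0 : (0 : ℝ) < N := by exact_mod_cast hN
  have hL : 0 ≤ Real.log N := Real.log_nonneg (by exact_mod_cast hN)
  obtain ⟨ε, hε⟩ := hsigns N hN
  set a : ((Σ i, Fin (n i)) → Fin N) → 𝕜 := fun J => boolSign 𝕜 (ε J) with ha
  have hP := isMultiPoly_blockPoly n (ENNReal.ofReal p) a
  have hnorm := multiPolyNorm_blockPoly_le n hp0 a hε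
  have hlow : ENNReal.ofReal ((N : ℝ) ^ ((M : ℝ) / s))
      ≤ (∑' α : MultiIdx n, ‖monomCoeff hP α‖ₑ ^ s) ^ (1 / s) := by
    classical
    have h1 : ((N : ℝ≥0∞) ^ M) ≤ ∑' α : MultiIdx n, ‖monomCoeff hP α‖ₑ ^ s := by
      refine le_trans (le_of_eq ?_) (ENNReal.sum_le_tsum (univ.image (blockIdx n (N := N))))
      rw [sum_image fun _ _ _ _ h => blockIdx_injective n h]
      have hone : ∀ J : (Σ i, Fin (n i)) → Fin N, ‖monomCoeff hP (blockIdx n J)‖ₑ ^ s = 1 := by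
        intro J
        rw [monomCoeff_blockPoly, ← ofReal_norm, norm_boolSign]
        simp
      simp [hone, hcard]
    refine le_trans (le_of_eq ?_) (ENNReal.rpow_le_rpow h1 (by positivity))
    rw [← ENNReal.rpow_natCast, ← ENNReal.rpow_mul, mul_one_div,
      ← ENNReal.ofReal_rpow_of_pos hN0, ENNReal.ofReal_natCast]
  have hfin := hlow.trans ((h _ hP).trans (mul_le_mul_right hnorm _))
  rw [← ENNReal.ofReal_mul (by linarith), ENNReal.ofReal_le_ofReal_iff (by positivity)] at hfin
  have hlt' := mul_lt_mul_of_pos_right hbig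
    (Real.rpow_pos_of_pos hN0 (1 / 2 + M * (1 / 2 - 1 / p)))
  rw [← Real.rpow_add hN0, sub_add_cancel] at hlt'
  linarith

end Lower

/-! ### The characterization -/

theorem theorem3p1 (𝕜 : Type*) [RCLike 𝕜] (m : ℕ) (hm : 1 ≤ m) (n : Fin m → ℕ)
    (hn : ∀ i, 1 ≤ n i) (M : ℕ) (hM : M = ∑ i, n i) (p : ℝ) (hp : 2 * (M : ℝ) ≤ p)
    (s : ℝ) (hs : 0 < s) :
    (∃ C : ℝ, 1 ≤ C ∧
      ∀ (P : (Fin m → EllP 𝕜 (ENNReal.ofReal p)) → 𝕜) (hP : IsMultiPoly 𝕜 n P),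
        (∑' α : MultiIdx n, ‖monomCoeff hP α‖ₑ ^ s) ^ (1 / s)
          ≤ ENNReal.ofReal C * multiPolyNorm P) ↔
    s ≥ 2 * M * p / (M * p + p - 2 * M) := by
  have hM1 : 1 ≤ M := by
    rw [hM]
    exact (hn ⟨0, hm⟩).trans
      (Finset.single_le_sum (fun _ _ => Nat.zero_le _) (Finset.mem_univ (⟨0, hm⟩ : Fin m)))
  constructor
  · rintro ⟨C, hC, h⟩
    exact exponent_le_of_monomCoeff_bound hM hM1 hp hs hC h
  · exact fun h => exists_monomCoeff_bound hM hM1 hp hs h
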